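/- **Conventions.** $\mathbb N=\{1,2,\dots\}$; $c_{00}$ is the space of finitely supported real sequences $(x(i))_{i\in\mathbb N}$ with unit vectors $e_n$; for $f,x\in c_{00}$ put $f(x)=\sum_i f(i)x(i)$. For nonzero $f,g\in c_{00}$ write $f<g$ if $\max\operatorname{supp}f<\min\operatorname{supp}g$, and let $\operatorname{ran}f$ be the smallest interval of $\mathbb N$ containing $\operatorname{supp} f$. For $I\subset\mathbb N$, $If$ is the restriction of $f$ to $I$. The Schreier families are $\mathcal S_0=\{\{n\}:n\in\mathbb N\}$, $\mathcal S_1=\{F\subset\mathbb N:\#F\le\min F\}$ (with $\varnothing\in\mathcal S_1$), and $\mathcal S_{n+1}$ is the family of all $F=\bigcup_{j=1}^kF_j$ with $F_1<\dots<F_k$ in $\mathcal S_n$ and $k\le\min F_1$. A sequence $f_1<\dots<f_d$ of nonzero vectors is $\mathcal S_n$-admissible if $\{\min\operatorname{supp}f_j: j\le d\}\in\mathcal S_n$. **Coding.** Let $L=\{\ell_1<\ell_2<\dots\}\subset\mathbb N$ be infinite with $\ell_1>2$, $\ell_{k+1}>2^{2\ell_k}$ for all $k$ and $\sum_k2^{-\ell_k}<\frac1{1000}$;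 let $L=L_1\cup L_2$ with $L_1,L_2$ infinite and disjoint. Let $\mathcal Q$ be the set of all finite sequences $((f_1,n_1),\dots,(f_m,n_m))$ with $m\ge 1$, $n_k\in\mathbb N$ and $f_1<\dots<f_m$ nonzero vectors of $c_{00}$ with rational coordinates, and let $\sigma:\mathcal Q\to L_2$ be one to one with $\sigma((f_1,n_1),\dots,(f_m,n_m))>2^{n_m}\max\operatorname{supp}f_m$. **The space.** Let $W$ be the smallest subset of $c_{00}$ such that: 1. $\pm e_n\in W$ for all $n$; if $f\in W$ then $-f\in W$ and $If\in W$ for every interval $I$ of $\mathbb N$; and $W$ is closed under rational convex combinations. 2. $\frac1{2^n}\sum_{j=1}^d\alpha_j\in W$ whenever $n\in\mathbb N$ and $\alpha_1<\dots<\alpha_d$ is an $\mathcal S_n$-admissible very fast growing sequence of $\alpha$-averages. If $f$ is of this form and $I$ is an interval, $\pm If$ is called a functional of type $\mathrm I_\alpha$ of weight $n$. 3. $\frac1{2^n}\sum_{j=1}^d\beta_j\in W$ whenever $n\in\mathbb N$ and $\beta_1<\dots<\beta_d$ is an $\mathcal S_n$-admissible very fast growing sequence of $\beta$-averages. 4.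 $f=\frac12\sum_{j=1}^df_j\in W$ whenever $f_1<\dots<f_d$ is $\mathcal S_1$-admissible, each $f_j$ is a functional of type $\mathrm I_\alpha$ of weight $w_j$, $w_1\in L_1$ and $w_j=\sigma((f_1,w_1),\dots,(f_{j-1},w_{j-1}))$ for $1<j\le d$. If $I$ is an interval, $g=\pm If$ is called a functional of type $\mathrm{II}$ with weights $\widehat w(g)=\{w_j:\operatorname{ran}f_j\cap I\ne\varnothing\}$. Here an $\alpha$-average of size $n$ is an element of $W$ of the form $\frac1n\sum_{j=1}^df_j$ with $1\le d\le n$ and $f_1<\dots<f_d$ in $W$; a $\beta$-average of size $n$ is an element of $W$ of the form $\frac1n\sum_{j=1}^df_j$ with $1\le d\le n$, where the $f_j\in W$ are functionals of type $\mathrm{II}$ with pairwise disjoint sets of weights $\widehat w(f_j)$. A sequence $a_1<a_2<\dots<a_d$ of averages of sizes $s_1,\dots,s_d$ is very fast growing if $s_j>2^{\max\operatorname{supp}a_{j-1}}$ and $s_j>s_{j-1}$ for $1<j\le d$. For $x\in c_{00}$ put $\|x\|=\sup\{f(x):f\in W\}$, and let $\mathfrak X_{\rm ISP}$ be the completion of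 $(c_{00},\|\cdot\|)$. **Statement.** For every choice of $L,L_1,L_2,\sigma$ as above: * (i) $\mathfrak X_{\rm ISP}$ is reflexive. * (ii) $(e_n)_{n\in\mathbb N}$ is a Schauder basis of $\mathfrak X_{\rm ISP}$ which is shrinking (the closed linear span of its coordinate functionals is the whole dual $\mathfrak X_{\rm ISP}^*$) and boundedly complete ($\sum_na_ne_n$ converges whenever $\sup_N\|\sum_{n\le N}a_ne_n\|<\infty$). * (iii) Let $n\ge1$, $\varepsilon\in\mathbb R$, and let $x_1<\dots<x_m$ be nonzero vectors in $c_{00}$ with $\|x_k\|\le1$, and $c_1,\dots,c_m$ scalars such that $\sum_{k=1}^mc_kx_k$ is an $(n,\varepsilon)$ special convex combination, i.e. with $\psi(k)=\min\operatorname{supp}x_k$ the vector $\sum_kc_ke_{\psi(k)}$ is of the form $y=\sum_{i\in F}b_ie_i$ with $F\in\mathcal S_n$, $b_i\ge0$, $\sum_{i\in F}b_i=1$, and $\sum_{i\in G}b_i<\varepsilon$ for all $G\subset F$ with $G\in\mathcal S_{n-1}$. Then for every $A\subset\{1,\dots,m\}$ $$\Big\|\sum_{k\in A}c_kx_k\Big\|\le\frac6{2^n}\sum_{k\in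 A}c_k+12\varepsilon ,$$ and in particular $\big\|\sum_{k=1}^mc_kx_k\big\|\le\frac6{2^n}+12\varepsilon$. -/

import Mathlib

open Filter Topology

namespace ISP

/-- The space `c₀₀` of finitely supported real sequences, with coordinates `1, 2, 3, …`. -/
abbrev c00 : Type := ℕ+ →₀ ℝ

/-- `e n` is the `n`-th unit vector of `c₀₀`. -/
noncomputable abbrev unitVec (n : ℕ+) : c00 := Finsupp.single n 1

/-! ### Supports, ranges, block sequences -/

/-- `f < g`: every element of the support of `f` is below every element of the support of `g`. -/
def Precedes (f g : c00) : Prop := ∀ a ∈ f.support, ∀ b ∈ g.support, a < b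

/-- The minimum of the support of a nonzero vector (and `1` for the zero vector). -/
noncomputable def minSupp (f : c00) : ℕ+ :=
  if h : f.support.Nonempty then f.support.min' h else 1

/-- The range of `f`: the smallest interval of positive integers containing its support. -/
def ran (f : c00) : Set ℕ+ := {i | ∃ a ∈ f.support, ∃ b ∈ f.support, a ≤ i ∧ i ≤ b}

open Classical in
/-- The restriction `I f` of `f` to a set `I` of coordinates. -/
noncomputable def restrict (I : Set ℕ+) (f : c00) : c00 := f.filter (fun i => i ∈ I)

/-- `f 0 < f 1 < ⋯ < f (d - 1)`, all of them nonzero. -/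
def IsBlock (d : ℕ) (f : ℕ → c00) : Prop :=
  (∀ i < d, f i ≠ 0) ∧ ∀ j < d, ∀ i < j, Precedes (f i) (f j)

/-! ### Schreier families -/

/-- The Schreier families: `S 0` consists of the singletons, and `F` belongs to `S (n + 1)` when
`F` is a union of nonempty sets `E 0 < E 1 < ⋯ < E (k - 1)` in `S n` with `k ≤ min F`. -/
def Schreier : ℕ → Set (Finset ℕ+)
  | 0 => {F | ∃ n, F = {n}}
  | n + 1 => {F | ∃ (k : ℕ) (E : ℕ → Finset ℕ+),
      (∀ j < k, (E j).Nonempty ∧ E j ∈ Schreier n) ∧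
      (∀ j < k, ∀ i < j, ∀ a ∈ E i, ∀ b ∈ E j, a < b) ∧
      F = (Finset.range k).biUnion E ∧
      ∀ m ∈ F, k ≤ (m : ℕ)}

/-- `S 1` is the usual family `{F : #F ≤ min F}`. -/
theorem mem_schreier_one (F : Finset ℕ+) :
    F ∈ Schreier 1 ↔ ∀ m ∈ F, F.card ≤ (m : ℕ) := by
  constructor
  · rintro ⟨k, E, hE, -, rfl, hk⟩ m hm
    refine le_trans ?_ (hk m hm)
    refine Finset.card_biUnion_le.trans ?_
    calc ∑ i ∈ Finset.range k, (E i).card ≤ ∑ i ∈ Finset.range k, 1 := by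
          refine Finset.sum_le_sum fun i hi => ?_
          obtain ⟨n, hn⟩ := (hE i (Finset.mem_range.1 hi)).2
          simp [hn]
      _ = k := by simp
  · intro h
    refine ⟨F.card, fun i => if hi : i < F.card then {F.orderEmbOfFin rfl ⟨i, hi⟩} else ∅,
      ?_, ?_, ?_, h⟩
    · intro j hj
      simp only [hj, dif_pos, Finset.singleton_nonempty, true_and]
      exact ⟨_, rfl⟩
    · intro j hj i hi a ha b hb
      have hi' := hi.trans hj
      simp only [hj, hi', dif_pos, Finset.mem_singleton] at ha hb
      subst ha hb
      exact (F.orderEmbOfFin rfl).strictMono hi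
    · ext a
      simp only [Finset.mem_biUnion, Finset.mem_range]
      constructor
      · intro ha
        have : a ∈ Set.range (F.orderEmbOfFin rfl) := by simpa using ha
        obtain ⟨⟨i, hi⟩, rfl⟩ := this
        exact ⟨i, hi, by simp [hi]⟩
      · rintro ⟨i, hi, ha⟩
        simp only [hi, dif_pos, Finset.mem_singleton] at ha
        subst ha
        simp

/-- The block sequence `f 0 < ⋯ < f (d - 1)` is `S n`-admissible. -/
def IsAdmissible (n d : ℕ) (f : ℕ → c00) : Prop :=
  0 < d ∧ IsBlock d f ∧ (Finset.range d).image (fun i => minSupp (f i)) ∈ Schreier n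

/-! ### The coding function -/

/-- The finite nonempty sequences `((f₁, n₁), …, (fₘ, nₘ))` with `f₁ < ⋯ < fₘ` nonzero finitely
supported vectors with rational coordinates and `n₁, …, nₘ` positive integers. -/
def codingDomain : Set (List (c00 × ℕ)) :=
  {l | l ≠ [] ∧ (∀ p ∈ l, p.1 ≠ 0 ∧ (∀ i, ∃ q : ℚ, p.1 i = (q : ℝ)) ∧ 0 < p.2) ∧
    l.Pairwise (fun p q => Precedes p.1 q.1)}

/-- The choices made before the space is defined: the set `L = {ℓ₁ < ℓ₂ < ⋯}`, its decomposition
into infinite sets `L₁, L₂`, and the coding function `σ` (only its values on `codingDomain`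
matter). Here `ell k` is `ℓ_{k+1}`; the series is summable because `ell` is strictly increasing. -/
structure CodingData where
  ell : ℕ → ℕ
  two_lt_ell : 2 < ell 0
  ell_growth : ∀ k, 2 ^ (2 * ell k) < ell (k + 1)
  ell_sum : ∑' k, (1 / (2 : ℝ) ^ ell k) < 1 / 1000
  L₁ : Set ℕ
  L₂ : Set ℕ
  L₁_infinite : L₁.Infinite
  L₂_infinite : L₂.Infinite
  disjoint_L : Disjoint L₁ L₂
  union_L : L₁ ∪ L₂ = Set.range ell
  σ : List (c00 × ℕ) → ℕ
  σ_injOn : Set.InjOn σ codingDomain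
  σ_mem : ∀ l ∈ codingDomain, σ l ∈ L₂
  σ_growth : ∀ l f n, l ++ [(f, n)] ∈ codingDomain →
    ∀ i ∈ f.support, 2 ^ n * (i : ℕ) < σ (l ++ [(f, n)])

/-- Such choices exist. -/
instance : Nonempty CodingData := by
  classical
  let ell : ℕ → ℕ := fun k => Nat.rec 100 (fun _ a => 2 ^ (2 * a) + 1) k
  have e0 : ell 0 = 100 := rfl
  have es : ∀ k, ell (k + 1) = 2 ^ (2 * ell k) + 1 := fun k => rfl
  have hgrow : ∀ k, 2 ^ (2 * ell k) < ell (k + 1) := fun k => by rw [es]; exact Nat.lt_succ_self _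
  have hsm : StrictMono ell := strictMono_nat_of_lt_succ fun k => by
    have h1 : 2 * ell k < 2 ^ (2 * ell k) := Nat.lt_two_pow_self
    have h2 := hgrow k
    omega
  have hadd : ∀ k, 100 + k ≤ ell k := by
    intro k
    induction k with
    | zero => exact e0.ge
    | succ k ih =>
      have : ell k < ell (k + 1) := hsm (Nat.lt_succ_self k)
      omega
  have hsum : ∑' k, (1 / (2 : ℝ) ^ ell k) < 1 / 1000 := by
    have hg : HasSum (fun k : ℕ => (1 / 2 : ℝ) ^ 100 * (1 / 2) ^ k) ((1 / 2 : ℝ) ^ 100 * 2) :=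
      hasSum_geometric_two.mul_left _
    have hle : ∀ k, (1 / (2 : ℝ) ^ ell k) ≤ (1 / 2 : ℝ) ^ 100 * (1 / 2) ^ k := fun k => by
      rw [← pow_add, ← one_div_pow]
      exact pow_le_pow_of_le_one (by norm_num) (by norm_num) (hadd k)
    have hs : Summable fun k => (1 / (2 : ℝ) ^ ell k) :=
      Summable.of_nonneg_of_le (fun k => by positivity) hle hg.summable
    calc ∑' k, (1 / (2 : ℝ) ^ ell k) ≤ (1 / 2 : ℝ) ^ 100 * 2 :=
          (hs.tsum_le_tsum hle hg.summable).trans hg.tsum_eq.le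
      _ < 1 / 1000 := by norm_num
  have hcount : codingDomain.Countable := by
    let F : List ((ℕ+ →₀ ℚ) × ℕ) → List (c00 × ℕ) :=
      List.map fun p => (p.1.mapRange (fun q : ℚ => (q : ℝ)) (by simp), p.2)
    refine (Set.countable_range F).mono ?_
    rintro l ⟨-, hl, -⟩
    have hr : ∀ p ∈ l, ∃ p' : (ℕ+ →₀ ℚ) × ℕ,
        (p'.1.mapRange (fun q : ℚ => (q : ℝ)) (by simp), p'.2) = p := by
      rintro ⟨f, n⟩ hp
      obtain ⟨-, hq, -⟩ := hl _ hp
      choose q hq using hq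
      refine ⟨(Finsupp.onFinset f.support q fun i hi => ?_, n), ?_⟩
      · rw [Finsupp.mem_support_iff, hq i]
        exact_mod_cast hi
      · refine Prod.ext (Finsupp.ext fun i => ?_) rfl
        simp [hq i]
    clear hl
    induction l with
    | nil => exact ⟨[], rfl⟩
    | cons p l ih =>
      obtain ⟨p', hp'⟩ := hr p (by simp)
      obtain ⟨l', hl'⟩ := ih fun x hx => hr x (by simp [hx])
      exact ⟨p' :: l', by rw [← hp', ← hl']; rfl⟩
  obtain ⟨enc, henc⟩ := Set.countable_iff_exists_injOn.1 hcount
  let bd : List (c00 × ℕ) → ℕ := fun l =>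
    (l.map fun p => 2 ^ p.2 * (p.1.support.sup fun i => (i : ℕ))).sum
  have hodd : Function.Injective fun k => ell (2 * k + 1) := fun a b h => by
    have : 2 * a + 1 = 2 * b + 1 := hsm.injective h
    omega
  have heven : Function.Injective fun k => ell (2 * k) := fun a b h => by
    have : 2 * a = 2 * b := hsm.injective h
    omega
  refine ⟨{
    ell := ell
    two_lt_ell := by rw [e0]; norm_num
    ell_growth := hgrow
    ell_sum := hsum
    L₁ := Set.range fun k => ell (2 * k)
    L₂ := Set.range fun k => ell (2 * k + 1)
    L₁_infinite := Set.infinite_range_of_injective heven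
    L₂_infinite := Set.infinite_range_of_injective hodd
    disjoint_L := ?_
    union_L := ?_
    σ := fun l => ell (2 * Nat.pair (enc l) (bd l) + 1)
    σ_injOn := ?_
    σ_mem := fun l _ => ⟨_, rfl⟩
    σ_growth := ?_ }⟩
  · rw [Set.disjoint_left]
    rintro _ ⟨a, rfl⟩ ⟨b, h⟩
    have : 2 * b + 1 = 2 * a := hsm.injective h
    omega
  · ext n
    constructor
    · rintro (⟨a, rfl⟩ | ⟨a, rfl⟩)
      · exact ⟨2 * a, rfl⟩
      · exact ⟨2 * a + 1, rfl⟩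
    · rintro ⟨a, rfl⟩
      rcases Nat.even_or_odd' a with ⟨b, rfl | rfl⟩
      · exact Or.inl ⟨b, rfl⟩
      · exact Or.inr ⟨b, rfl⟩
  · intro l hl l' hl' h
    have h1 := hodd h
    exact henc hl hl' (Nat.pair_eq_pair.1 h1).1
  · intro l f n _ i hi
    have h1 : (i : ℕ) ≤ f.support.sup fun i => (i : ℕ) := Finset.le_sup (f := fun i : ℕ+ => (i : ℕ)) hi
    have h2 : 2 ^ n * (i : ℕ) ≤ bd (l ++ [(f, n)]) := by
      simp only [bd, List.map_append, List.sum_append, List.map_cons, List.map_nil, List.sum_cons,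
        List.sum_nil, add_zero]
      exact (Nat.mul_le_mul_left _ h1).trans (Nat.le_add_left _ _)
    have h3 := Nat.right_le_pair (enc (l ++ [(f, n)])) (bd (l ++ [(f, n)]))
    have h4 := hadd (2 * Nat.pair (enc (l ++ [(f, n)])) (bd (l ++ [(f, n)])) + 1)
    omega

/-! ### The norming set

All notions below are relative to a set `G` of functionals; they are monotone in `G`, and the
norming set is the smallest set closed under them. -/

/-- `a` is an `α`-average of size `n` in `G`. -/
def IsAlphaAverage (G : Set c00) (n : ℕ) (a : c00) : Prop :=
  a ∈ G ∧ ∃ (d : ℕ) (f : ℕ → c00), 0 < d ∧ d ≤ n ∧ (∀ i < d, f i ∈ G) ∧ IsBlock d f ∧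
    a = (1 / (n : ℝ)) • ∑ i ∈ Finset.range d, f i

/-- A sequence `f 0 < ⋯ < f (d - 1)` of averages of sizes `s 0, …, s (d - 1)` is very fast
growing. -/
def IsVeryFastGrowing (d : ℕ) (s : ℕ → ℕ) (f : ℕ → c00) : Prop :=
  IsBlock d f ∧
    ∀ j, j + 1 < d → (∀ i ∈ (f j).support, 2 ^ (i : ℕ) < s (j + 1)) ∧ s j < s (j + 1)

/-- `f = 2⁻ⁿ (a₁ + ⋯ + a_d)` for an `S n`-admissible very fast growing sequence `a₁, …, a_d`, where
each `a_j` is an average of size `s_j` in the sense of `Avg s_j a_j`. -/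
def IsWeighted (Avg : ℕ → c00 → Prop) (n : ℕ) (f : c00) : Prop :=
  0 < n ∧ ∃ (d : ℕ) (s : ℕ → ℕ) (a : ℕ → c00), (∀ j < d, Avg (s j) (a j)) ∧
    IsAdmissible n d a ∧ IsVeryFastGrowing d s a ∧
    f = (1 / (2 : ℝ) ^ n) • ∑ j ∈ Finset.range d, a j

/-- `g = ± I f` for some interval `I` of the positive integers. -/
def IsSignedRestriction (I : Set ℕ+) (f g : c00) : Prop :=
  I.OrdConnected ∧ (g = restrict I f ∨ g = -restrict I f)

/-- `g` is a functional of type `I_α` and weight `n`. -/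
def IsTypeIAlpha (G : Set c00) (n : ℕ) (g : c00) : Prop :=
  ∃ f I, IsWeighted (IsAlphaAverage G) n f ∧ IsSignedRestriction I f g

/-- `f 0, …, f (d - 1)` is an `S 1`-admissible special sequence of type `I_α` functionals, with
weights `w 0, …, w (d - 1)`. -/
def IsSpecial (D : CodingData) (G : Set c00) (d : ℕ) (f : ℕ → c00) (w : ℕ → ℕ) : Prop :=
  IsAdmissible 1 d f ∧ (∀ j < d, IsTypeIAlpha G (w j) (f j)) ∧ w 0 ∈ D.L₁ ∧
    ∀ j < d, 0 < j → w j = D.σ ((List.range j).map (fun i => (f i, w i)))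

/-- `g` is a functional of type `II` with set of weights `wt`. -/
def IsTypeII (D : CodingData) (G : Set c00) (wt : Set ℕ) (g : c00) : Prop :=
  ∃ (d : ℕ) (f : ℕ → c00) (w : ℕ → ℕ) (I : Set ℕ+), IsSpecial D G d f w ∧
    IsSignedRestriction I ((1 / (2 : ℝ)) • ∑ j ∈ Finset.range d, f j) g ∧
    wt = {n | ∃ j < d, (ran (f j) ∩ I).Nonempty ∧ n = w j}

/-- `b` is a `β`-average of size `n` in `G`. -/
def IsBetaAverage (D : CodingData) (G : Set c00) (n : ℕ) (b : c00) : Prop :=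
  b ∈ G ∧ ∃ (d : ℕ) (f : ℕ → c00) (wt : ℕ → Set ℕ), 0 < d ∧ d ≤ n ∧
    (∀ i < d, f i ∈ G ∧ IsTypeII D G (wt i) (f i)) ∧
    (∀ j < d, ∀ i < j, Disjoint (wt i) (wt j)) ∧
    b = (1 / (n : ℝ)) • ∑ i ∈ Finset.range d, f i

/-- The closure properties in the definition of the norming set. -/
structure IsClosedFamily (D : CodingData) (G : Set c00) : Prop where
  unit_mem : ∀ n, unitVec n ∈ G
  neg_mem : ∀ f ∈ G, -f ∈ G
  restrict_mem : ∀ f ∈ G, ∀ I : Set ℕ+, I.OrdConnected → restrict I f ∈ G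
  convex_mem : ∀ (d : ℕ) (f : ℕ → c00) (q : ℕ → ℚ), (∀ i < d, f i ∈ G) → (∀ i < d, 0 ≤ q i) →
    ∑ i ∈ Finset.range d, q i = 1 → ∑ i ∈ Finset.range d, (q i : ℝ) • f i ∈ G
  typeIAlpha_mem : ∀ n f, IsWeighted (IsAlphaAverage G) n f → f ∈ G
  typeIBeta_mem : ∀ n f, IsWeighted (IsBetaAverage D G) n f → f ∈ G
  typeII_mem : ∀ d f w, IsSpecial D G d f w →
    (1 / (2 : ℝ)) • ∑ j ∈ Finset.range d, f j ∈ G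

/-- The norming set `W`: the smallest family with the closure properties above. -/
def normingSet (D : CodingData) : Set c00 := ⋂₀ {G | IsClosedFamily D G}

/-- The action `f(x) = ∑ᵢ f(i) x(i)` of a functional on a vector. -/
noncomputable def act (f x : c00) : ℝ := f.sum fun i c => c * x i

/-- `sup {f(x) : f ∈ W}`. -/
noncomputable def wNorm (D : CodingData) (x : c00) : ℝ :=
  sSup {r | ∃ f ∈ normingSet D, r = act f x}

/-! ### The norming set is the smallest closed family -/

theorem IsAlphaAverage.mono {G H : Set c00} (h : G ⊆ H) {n : ℕ} {a : c00}
    (ha : IsAlphaAverage G n a) : IsAlphaAverage H n a := by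
  obtain ⟨h1, d, f, hd, hn, hf, hb, he⟩ := ha
  exact ⟨h h1, d, f, hd, hn, fun i hi => h (hf i hi), hb, he⟩

theorem IsWeighted.mono {A B : ℕ → c00 → Prop} (h : ∀ n f, A n f → B n f) {n : ℕ} {f : c00}
    (hf : IsWeighted A n f) : IsWeighted B n f := by
  obtain ⟨hn, d, s, a, ha, h1, h2, h3⟩ := hf
  exact ⟨hn, d, s, a, fun j hj => h _ _ (ha j hj), h1, h2, h3⟩

theorem IsTypeIAlpha.mono {G H : Set c00} (h : G ⊆ H) {n : ℕ} {g : c00}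
    (hg : IsTypeIAlpha G n g) : IsTypeIAlpha H n g := by
  obtain ⟨f, I, hf, hI⟩ := hg
  exact ⟨f, I, hf.mono fun _ _ => IsAlphaAverage.mono h, hI⟩

theorem IsSpecial.mono {D : CodingData} {G H : Set c00} (h : G ⊆ H) {d : ℕ} {f : ℕ → c00}
    {w : ℕ → ℕ} (hf : IsSpecial D G d f w) : IsSpecial D H d f w :=
  ⟨hf.1, fun j hj => (hf.2.1 j hj).mono h, hf.2.2⟩

theorem IsTypeII.mono {D : CodingData} {G H : Set c00} (h : G ⊆ H) {wt : Set ℕ} {g : c00}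
    (hg : IsTypeII D G wt g) : IsTypeII D H wt g := by
  obtain ⟨d, f, w, I, h1, h2⟩ := hg
  exact ⟨d, f, w, I, h1.mono h, h2⟩

theorem IsBetaAverage.mono {D : CodingData} {G H : Set c00} (h : G ⊆ H) {n : ℕ} {b : c00}
    (hb : IsBetaAverage D G n b) : IsBetaAverage D H n b := by
  obtain ⟨h1, d, f, wt, hd, hn, hf, h2⟩ := hb
  exact ⟨h h1, d, f, wt, hd, hn, fun i hi => ⟨h (hf i hi).1, (hf i hi).2.mono h⟩, h2⟩

theorem normingSet_subset {D : CodingData} {G : Set c00} (hG : IsClosedFamily D G) :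
    normingSet D ⊆ G := Set.sInter_subset_of_mem hG

theorem isClosedFamily_normingSet (D : CodingData) : IsClosedFamily D (normingSet D) where
  unit_mem n := fun _ hG => hG.unit_mem n
  neg_mem f hf := fun G hG => hG.neg_mem f (hf G hG)
  restrict_mem f hf I hI := fun G hG => hG.restrict_mem f (hf G hG) I hI
  convex_mem d f q hf hq h1 := fun G hG => hG.convex_mem d f q (fun i hi => hf i hi G hG) hq h1
  typeIAlpha_mem n f hf := fun _ hG =>
    hG.typeIAlpha_mem n f (hf.mono fun _ _ => IsAlphaAverage.mono (normingSet_subset hG))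
  typeIBeta_mem n f hf := fun _ hG =>
    hG.typeIBeta_mem n f (hf.mono fun _ _ => IsBetaAverage.mono (normingSet_subset hG))
  typeII_mem d f w hf := fun _ hG => hG.typeII_mem d f w (hf.mono (normingSet_subset hG))

/-! ### The supremum defines a norm -/

theorem restrict_apply_eq (I : Set ℕ+) (f : c00) (i : ℕ+) :
    restrict I f i = f i ∨ restrict I f i = 0 := by
  classical
  unfold restrict
  rw [Finsupp.filter_apply]
  split_ifs <;> simp

theorem IsBlock.abs_sum_le {d : ℕ} {f : ℕ → c00} (hb : IsBlock d f)
    (hf : ∀ j < d, ∀ i, |f j i| ≤ 1) (i : ℕ+) : |(∑ j ∈ Finset.range d, f j) i| ≤ 1 := by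
  rw [Finsupp.finsetSum_apply]
  by_cases h : ∃ j < d, f j i ≠ 0
  · obtain ⟨j, hj, hji⟩ := h
    rw [Finset.sum_eq_single j]
    · exact hf j hj i
    · intro k hk hkj
      by_contra hki
      rcases lt_or_gt_of_ne hkj with hlt | hlt
      · exact lt_irrefl i (hb.2 j hj k hlt i (by simpa using hki) i (by simpa using hji))
      · exact lt_irrefl i
          (hb.2 k (Finset.mem_range.1 hk) j hlt i (by simpa using hji) i (by simpa using hki))
    · intro h
      exact absurd (Finset.mem_range.2 hj) h
  · push Not at h
    rw [Finset.sum_eq_zero fun j hj => h j (Finset.mem_range.1 hj)]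
    simp

theorem IsWeighted.abs_le {A : ℕ → c00 → Prop} (hA : ∀ n f, A n f → ∀ i, |f i| ≤ 1) {n : ℕ}
    {f : c00} (hf : IsWeighted A n f) (i : ℕ+) : |f i| ≤ 1 := by
  obtain ⟨-, d, s, a, ha, h1, -, rfl⟩ := hf
  have := h1.2.1.abs_sum_le (fun j hj => hA _ _ (ha j hj)) i
  rw [Finsupp.smul_apply, smul_eq_mul, abs_mul]
  refine mul_le_one₀ ?_ (abs_nonneg _) this
  rw [abs_of_nonneg (by positivity)]
  exact div_le_one_of_le₀ (one_le_pow₀ (by norm_num)) (by positivity)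

theorem IsSignedRestriction.abs_le {I : Set ℕ+} {f g : c00} (h : IsSignedRestriction I f g)
    (hf : ∀ i, |f i| ≤ 1) (i : ℕ+) : |g i| ≤ 1 := by
  rcases h.2 with rfl | rfl <;> rcases restrict_apply_eq I f i with h | h <;> simp [h, hf i]

/-- Functionals in the norming set have coordinates in `[-1, 1]`. -/
theorem abs_apply_le_one {D : CodingData} {f : c00} (hf : f ∈ normingSet D) (i : ℕ+) :
    |f i| ≤ 1 := by
  have : IsClosedFamily D {f : c00 | ∀ i, |f i| ≤ 1} := by
    refine ⟨?_, ?_, ?_, ?_, ?_, ?_, ?_⟩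
    · intro n i
      rw [Finsupp.single_apply]
      split_ifs <;> simp
    · intro f hf i
      simpa using hf i
    · intro f hf I _ i
      rcases restrict_apply_eq I f i with h | h <;> simp [h, hf i]
    · intro d f q hf hq h1 i
      rw [Finsupp.finsetSum_apply]
      refine (Finset.abs_sum_le_sum_abs _ _).trans ?_
      have h2 : ∑ j ∈ Finset.range d, (q j : ℝ) = 1 := by exact_mod_cast h1
      rw [← h2]
      refine Finset.sum_le_sum fun j hj => ?_
      have hj := Finset.mem_range.1 hj
      have hq' : (0 : ℝ) ≤ q j := by exact_mod_cast hq j hj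
      rw [Finsupp.smul_apply, smul_eq_mul, abs_mul, abs_of_nonneg hq']
      exact mul_le_of_le_one_right hq' (hf j hj i)
    · intro n f hf
      exact hf.abs_le fun _ _ h => h.1
    · intro n f hf
      exact hf.abs_le fun _ _ h => h.1
    · intro d f w hf i
      have := hf.1.2.1.abs_sum_le (fun j hj => by
        obtain ⟨g, I, hg, hI⟩ := hf.2.1 j hj
        exact hI.abs_le (hg.abs_le fun _ _ h => h.1)) i
      rw [Finsupp.smul_apply, smul_eq_mul, abs_mul]
      refine mul_le_one₀ ?_ (abs_nonneg _) this
      norm_num [abs_of_nonneg]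
  exact normingSet_subset this hf i

theorem act_add (f x y : c00) : act f (x + y) = act f x + act f y := by
  simp [act, Finsupp.sum, mul_add, Finset.sum_add_distrib]

theorem act_smul (f : c00) (c : ℝ) (x : c00) : act f (c • x) = c * act f x := by
  simp [act, Finsupp.sum, Finset.mul_sum, mul_left_comm]

theorem act_neg_left (f x : c00) : act (-f) x = -act f x := by
  simp [act, Finsupp.sum]

theorem act_unitVec (n : ℕ+) (x : c00) : act (unitVec n) x = x n := by
  simp [act, unitVec]

theorem act_le_sum_abs {D : CodingData} {f : c00} (hf : f ∈ normingSet D) (x : c00) :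
    act f x ≤ ∑ i ∈ x.support, |x i| := by
  classical
  have h1 : act f x = ∑ i ∈ x.support, f i * x i := by
    unfold act Finsupp.sum
    rw [← Finset.sum_subset (Finset.inter_subset_left (s₁ := f.support) (s₂ := x.support)),
      ← Finset.sum_subset (Finset.inter_subset_right (s₁ := f.support) (s₂ := x.support))]
    · intro i hi hi'
      have : f i = 0 := by
        by_contra h
        exact hi' (Finset.mem_inter.2 ⟨Finsupp.mem_support_iff.2 h, hi⟩)
      simp [this]
    · intro i hi hi'
      have : x i = 0 := by
        by_contra h
        exact hi' (Finset.mem_inter.2 ⟨hi, Finsupp.mem_support_iff.2 h⟩)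
      simp [this]
  rw [h1]
  refine Finset.sum_le_sum fun i _ => (le_abs_self _).trans ?_
  rw [abs_mul]
  exact mul_le_of_le_one_left (abs_nonneg _) (abs_apply_le_one hf i)

theorem act_le_wNorm {D : CodingData} {f : c00} (hf : f ∈ normingSet D) (x : c00) :
    act f x ≤ wNorm D x := by
  refine le_csSup ⟨∑ i ∈ x.support, |x i|, ?_⟩ ⟨f, hf, rfl⟩
  rintro r ⟨g, hg, rfl⟩
  exact act_le_sum_abs hg x

theorem abs_act_le_wNorm {D : CodingData} {f : c00} (hf : f ∈ normingSet D) (x : c00) :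
    |act f x| ≤ wNorm D x := by
  refine abs_le'.2 ⟨act_le_wNorm hf x, ?_⟩
  rw [← act_neg_left]
  exact act_le_wNorm ((isClosedFamily_normingSet D).neg_mem f hf) x

theorem wNorm_le {D : CodingData} {x : c00} {C : ℝ}
    (h : ∀ f ∈ normingSet D, act f x ≤ C) : wNorm D x ≤ C := by
  refine csSup_le ⟨_, unitVec 1, (isClosedFamily_normingSet D).unit_mem 1, rfl⟩ ?_
  rintro r ⟨f, hf, rfl⟩
  exact h f hf

theorem wNorm_nonneg (D : CodingData) (x : c00) : 0 ≤ wNorm D x :=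
  (abs_nonneg _).trans (abs_act_le_wNorm ((isClosedFamily_normingSet D).unit_mem 1) x)

theorem wNorm_smul_le (D : CodingData) (c : ℝ) (x : c00) :
    wNorm D (c • x) ≤ |c| * wNorm D x := by
  refine wNorm_le fun f hf => ?_
  rw [act_smul]
  refine (le_abs_self _).trans ?_
  rw [abs_mul]
  exact mul_le_mul_of_nonneg_left (abs_act_le_wNorm hf x) (abs_nonneg c)

/-- The space `c₀₀` with the norm `‖x‖ = sup {f(x) : f ∈ W}`. -/
def NormedC00 (_D : CodingData) : Type := c00

namespace NormedC00

variable (D : CodingData)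

noncomputable instance : AddCommGroup (NormedC00 D) := inferInstanceAs (AddCommGroup c00)

noncomputable instance : Module ℝ (NormedC00 D) := inferInstanceAs (Module ℝ c00)

noncomputable instance : Norm (NormedC00 D) := ⟨fun x => wNorm D x⟩

theorem normCore : NormedSpace.Core ℝ (NormedC00 D) where
  norm_nonneg x := wNorm_nonneg D x
  norm_smul c x := by
    refine le_antisymm (wNorm_smul_le D c x) ?_
    rcases eq_or_ne c 0 with rfl | hc
    · rw [norm_zero, zero_mul]
      exact wNorm_nonneg D _
    · have h := wNorm_smul_le D c⁻¹ (c • (show c00 from x))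
      rw [smul_smul, inv_mul_cancel₀ hc, one_smul, abs_inv] at h
      calc ‖c‖ * ‖x‖ ≤ |c| * (|c|⁻¹ * wNorm D (c • (show c00 from x))) :=
            mul_le_mul_of_nonneg_left h (abs_nonneg c)
        _ = ‖c • x‖ := by
            rw [← mul_assoc, mul_inv_cancel₀ (abs_ne_zero.2 hc), one_mul]
            rfl
  norm_triangle x y := by
    refine wNorm_le fun f hf => ?_
    refine (act_add f x y).le.trans ?_
    exact add_le_add (act_le_wNorm hf x) (act_le_wNorm hf y)
  norm_eq_zero_iff x := by
    constructor
    · intro h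
      refine Finsupp.ext fun i => ?_
      have := abs_act_le_wNorm ((isClosedFamily_normingSet D).unit_mem i) (show c00 from x)
      rw [act_unitVec] at this
      exact abs_nonpos_iff.1 (this.trans h.le)
    · rintro rfl
      refine le_antisymm (wNorm_le fun f _ => ?_) (wNorm_nonneg D _)
      exact (Finset.sum_eq_zero fun i _ => mul_zero _).le

noncomputable instance : NormedAddCommGroup (NormedC00 D) := NormedAddCommGroup.ofCore (normCore D)

noncomputable instance : NormedSpace ℝ (NormedC00 D) where
  norm_smul_le c x := ((normCore D).norm_smul c x).le

end NormedC00

/-- The Banach space `𝔛_ISP`: the completion of `c₀₀` under `‖x‖ = sup {f(x) : f ∈ W}`. -/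
abbrev XISP (D : CodingData) : Type := UniformSpace.Completion (NormedC00 D)

/-- A finitely supported vector, as an element of `𝔛_ISP`. -/
noncomputable def toXISP (D : CodingData) (x : c00) : XISP D :=
  ((show NormedC00 D from x : NormedC00 D) : UniformSpace.Completion (NormedC00 D))

theorem norm_toXISP (D : CodingData) (x : c00) : ‖toXISP D x‖ = wNorm D x :=
  UniformSpace.Completion.norm_coe (show NormedC00 D from x)

/-! ### Special convex combinations -/

/-- `y = ∑_{k ∈ F} c_k e_k` is an `(n, ε)` basic special convex combination. -/
def IsBasicSCC (n : ℕ) (ε : ℝ) (y : c00) : Prop :=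
  ∃ F : Finset ℕ+, y.support ⊆ F ∧ F ∈ Schreier n ∧ (∀ k ∈ F, 0 ≤ y k) ∧ ∑ k ∈ F, y k = 1 ∧
    ∀ G ⊆ F, G ∈ Schreier (n - 1) → ∑ k ∈ G, y k < ε

/-- `∑_{k < m} c k • x k` is an `(n, ε)` special convex combination of the block sequence
`x 0 < ⋯ < x (m - 1)`. -/
def IsSCC (n : ℕ) (ε : ℝ) (m : ℕ) (c : ℕ → ℝ) (x : ℕ → c00) : Prop :=
  IsBlock m x ∧ IsBasicSCC n ε (∑ k ∈ Finset.range m, c k • unitVec (minSupp (x k)))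

/-! ### Bases and reflexivity -/

/-- A Schauder basis is shrinking if the closed linear span of its coordinate functionals is the
whole dual space. -/
def IsShrinking {X : Type*} [NormedAddCommGroup X] [NormedSpace ℝ X]
    (b : SchauderBasis ℝ X) : Prop :=
  (Submodule.span ℝ (Set.range b.coord)).topologicalClosure = ⊤

/-- A Schauder basis is boundedly complete if `∑ aᵢ bᵢ` converges for all scalars `aᵢ` for which
the partial sums are bounded. -/
def IsBoundedlyComplete {X : Type*} [NormedAddCommGroup X] [NormedSpace ℝ X]
    (b : SchauderBasis ℝ X) : Prop :=
  ∀ a : ℕ → ℝ, (∃ C : ℝ, ∀ n, ‖∑ i ∈ Finset.range n, a i • b i‖ ≤ C) →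
    ∃ x, Tendsto (fun n => ∑ i ∈ Finset.range n, a i • b i) atTop (𝓝 x)

/-- A real normed space is reflexive if its canonical embedding into the bidual is onto. -/
def IsReflexive (X : Type*) [NormedAddCommGroup X] [NormedSpace ℝ X] : Prop :=
  Function.Surjective (NormedSpace.inclusionInDoubleDual ℝ X)

end ISP

namespace ISP

/-! ### The pairing and restrictions -/

/-! Every functional built by the weighted rules or from a special sequence has one feature in
common: it is half of a sum `g 0 + ⋯ + g (d - 1)` of successive elements of `W` supported in `{d, d
+ 1, …}`. For weight `n + 1` this comes from splitting an `S (n + 1)`-admissible family into at most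
`min` many `S n`-admissible families and moving the factor `1 / 2 ^ n` inside each of them. So `W`
lies in the convex hull of its one-coordinate elements and its half sums
(`normingSet_subset_convexHull`), and the upper bounds reduce to Tsirelson-type estimates for half
sums.

The basic count is `IsHalfSum.exists_split`: on a block sequence, at most `d` vectors meet two or
more of the `g j`; the other vectors are divided among single `g j`, where the factor `1 / 2` is
gained. Iterating `n` times gives `exists_schreier_act_le`, hence the estimate for special convex
combinations, with constants 2 and 4 in place of 6 and 12.

The basis is shrinking because long averages of far-out blocks have smaller norm: if a bounded form
stayed above `δ > 0` on unit vectors arbitrarily far out, averaging would keep it above `δ` while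
multiplying the norm by `3 / 4` each time (`exists_wNorm_le_three_quarters`).

The basis is boundedly complete because of a lower estimate: if the partial sums are not Cauchy,
elements of `W` with supports arbitrarily far out act on the formal series by at least a fixed `δ >
0`. They can be grouped into very fast growing `α`-averages, and a functional of weight 1 over `d`
of these acts by at least `d * δ / 2`, which is unbounded (`exists_mem_normingSet_le`). Reflexivity
then follows from James' theorem. -/

theorem act_comm (f x : c00) : act f x = act x f := by
  classical
  have h : ∀ f x : c00, act f x = ∑ i ∈ f.support ∪ x.support, f i * x i := fun f x =>
    Finset.sum_subset Finset.subset_union_left fun i _ hi => by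
      simp [Finsupp.notMem_support_iff.1 hi]
  rw [h, h, Finset.union_comm]
  exact Finset.sum_congr rfl fun i _ => mul_comm _ _

/-- The pairing of `c₀₀` with itself, as a linear map. -/
noncomputable def actLin (f : c00) : c00 →ₗ[ℝ] ℝ where
  toFun := act f
  map_add' := act_add f
  map_smul' c x := act_smul f c x

theorem act_sum (f : c00) {ι : Type*} (s : Finset ι) (x : ι → c00) :
    act f (∑ k ∈ s, x k) = ∑ k ∈ s, act f (x k) :=
  map_sum (actLin f) x s

theorem act_sum_smul (f : c00) {ι : Type*} (s : Finset ι) (c : ι → ℝ) (x : ι → c00) :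
    act f (∑ k ∈ s, c k • x k) = ∑ k ∈ s, c k * act f (x k) := by
  simp only [act_sum, act_smul]

theorem sum_act {ι : Type*} (s : Finset ι) (f : ι → c00) (x : c00) :
    act (∑ k ∈ s, f k) x = ∑ k ∈ s, act (f k) x := by
  rw [act_comm, act_sum]
  exact Finset.sum_congr rfl fun k _ => act_comm _ _

theorem smul_act (c : ℝ) (f x : c00) : act (c • f) x = c * act f x := by
  rw [act_comm, act_smul, act_comm]

theorem act_eq_zero {f x : c00} (h : ∀ i ∈ f.support, i ∉ x.support) : act f x = 0 :=
  Finset.sum_eq_zero fun i hi => by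
    simp [Finsupp.notMem_support_iff.1 (h i hi)]

theorem support_restrict (I : Set ℕ+) (f : c00) {i : ℕ+} :
    i ∈ (restrict I f).support ↔ i ∈ f.support ∧ i ∈ I := by
  classical
  simp [restrict]

theorem restrict_apply (I : Set ℕ+) [DecidablePred (· ∈ I)] (f : c00) (i : ℕ+) :
    restrict I f i = if i ∈ I then f i else 0 := by
  simp only [restrict, Finsupp.filter_apply]
  congr

/-- Restriction to `I`, as a linear map. -/
noncomputable def restrictLin (I : Set ℕ+) : c00 →ₗ[ℝ] c00 where
  toFun := restrict I
  map_add' f g := by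
    classical
    ext i
    simp only [restrict_apply, Finsupp.add_apply]
    split_ifs <;> simp
  map_smul' c f := by
    classical
    ext i
    simp [restrict_apply]

theorem act_restrict (I : Set ℕ+) (f x : c00) : act (restrict I f) x = act f (restrict I x) := by
  classical
  have h : f.support.filter (· ∈ I) = (restrict I f).support := by
    ext i
    rw [support_restrict, Finset.mem_filter]
  unfold act Finsupp.sum
  rw [← h, Finset.sum_filter]
  refine Finset.sum_congr rfl fun i _ => ?_
  simp only [restrict_apply]
  split_ifs <;> simp

variable {D : CodingData}

theorem restrict_mem_normingSet {f : c00} (hf : f ∈ normingSet D) {I : Set ℕ+}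
    (hI : I.OrdConnected) : restrict I f ∈ normingSet D :=
  (isClosedFamily_normingSet D).restrict_mem f hf I hI

theorem neg_mem_normingSet {f : c00} (hf : f ∈ normingSet D) : -f ∈ normingSet D :=
  (isClosedFamily_normingSet D).neg_mem f hf

theorem wNorm_restrict_le (x : c00) {I : Set ℕ+} (hI : I.OrdConnected) :
    wNorm D (restrict I x) ≤ wNorm D x :=
  wNorm_le fun f hf => by
    rw [← act_restrict]
    exact act_le_wNorm (restrict_mem_normingSet hf hI) x

theorem IsSignedRestriction.mem_normingSet {I : Set ℕ+} {f g : c00}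
    (h : IsSignedRestriction I f g) (hf : f ∈ normingSet D) : g ∈ normingSet D := by
  rcases h with ⟨hI, rfl | rfl⟩
  · exact restrict_mem_normingSet hf hI
  · exact neg_mem_normingSet (restrict_mem_normingSet hf hI)

theorem IsTypeIAlpha.mem_normingSet {n : ℕ} {g : c00} (h : IsTypeIAlpha (normingSet D) n g) :
    g ∈ normingSet D := by
  obtain ⟨f, I, hf, hI⟩ := h
  exact hI.mem_normingSet ((isClosedFamily_normingSet D).typeIAlpha_mem n f hf)

/-! ### Block sequences -/

theorem minSupp_mem {f : c00} (hf : f ≠ 0) : minSupp f ∈ f.support := by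
  have h := Finsupp.support_nonempty_iff.2 hf
  rw [minSupp, dif_pos h]
  exact f.support.min'_mem h

theorem minSupp_le {f : c00} {i : ℕ+} (hi : i ∈ f.support) : minSupp f ≤ i := by
  rw [minSupp, dif_pos ⟨i, hi⟩]
  exact f.support.min'_le i hi

theorem IsBlock.minSupp_lt {d : ℕ} {f : ℕ → c00} (h : IsBlock d f) {i j : ℕ} (hj : j < d)
    (hij : i < j) : minSupp (f i) < minSupp (f j) :=
  h.2 j hj i hij _ (minSupp_mem (h.1 i (hij.trans hj))) _ (minSupp_mem (h.1 j hj))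

theorem IsBlock.lt_of_minSupp_lt {d : ℕ} {f : ℕ → c00} (h : IsBlock d f) {i j : ℕ} (hi : i < d)
    (hij : minSupp (f i) < minSupp (f j)) : i < j := by
  by_contra! hle
  rcases hle.eq_or_lt with rfl | hlt
  · exact hij.false
  · exact (hij.trans (h.minSupp_lt hi hlt)).false

theorem IsBlock.injOn_minSupp {d : ℕ} {f : ℕ → c00} (h : IsBlock d f) :
    Set.InjOn (fun i => minSupp (f i)) (Finset.range d : Set ℕ) := by
  intro i hi j hj hij
  simp only [Finset.coe_range, Set.mem_Iio] at hi hj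
  rcases lt_trichotomy i j with hlt | heq | hlt
  · exact absurd hij (h.minSupp_lt hj hlt).ne
  · exact heq
  · exact absurd hij (h.minSupp_lt hi hlt).ne'

theorem IsBlock.comp {d d' : ℕ} {f : ℕ → c00} (h : IsBlock d f) {t : ℕ → ℕ}
    (ht : ∀ i < d', t i < d) (hmono : ∀ i j, i < j → j < d' → t i < t j) :
    IsBlock d' (fun i => f (t i)) :=
  ⟨fun i hi => h.1 _ (ht i hi), fun j hj i hij => h.2 _ (ht j hj) _ (hmono i j hij hj)⟩

theorem IsVeryFastGrowing.lt_of_lt {d : ℕ} {s : ℕ → ℕ} {f : ℕ → c00}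
    (h : IsVeryFastGrowing d s f) {i j : ℕ} (hij : i < j) (hj : j < d) :
    (∀ a ∈ (f i).support, 2 ^ (a : ℕ) < s j) ∧ s i < s j := by
  induction j, hij using Nat.le_induction with
  | base => exact h.2 i hj
  | succ j hij ih =>
    have h1 := ih (by omega)
    have h2 := (h.2 j hj).2
    exact ⟨fun a ha => (h1.1 a ha).trans h2, h1.2.trans h2⟩

theorem IsVeryFastGrowing.comp {d d' : ℕ} {s : ℕ → ℕ} {f : ℕ → c00}
    (h : IsVeryFastGrowing d s f) {t : ℕ → ℕ}
    (ht : ∀ i < d', t i < d) (hmono : ∀ i j, i < j → j < d' → t i < t j) :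
    IsVeryFastGrowing d' (fun i => s (t i)) (fun i => f (t i)) :=
  ⟨h.1.comp ht hmono, fun j hj => h.lt_of_lt (hmono j _ j.lt_succ_self hj) (ht _ hj)⟩

/-- Block sequences are indexed by initial segments of `ℕ`, so a subfamily indexed by a finite set
`J` has to be renumbered increasingly before it is again a block sequence. -/
theorem exists_enum (J : Finset ℕ) : ∃ t : ℕ → ℕ, (∀ i < J.card, t i ∈ J) ∧
    (∀ i j, i < j → j < J.card → t i < t j) ∧ (Finset.range J.card).image t = J := by
  classical
  refine ⟨fun i => if h : i < J.card then J.orderEmbOfFin rfl ⟨i, h⟩ else 0, ?_, ?_, ?_⟩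
  · intro i hi
    simp only [hi, dif_pos]
    exact J.orderEmbOfFin_mem rfl _
  · intro i j hij hj
    simp only [hij.trans hj, hj, dif_pos]
    exact (J.orderEmbOfFin rfl).strictMono hij
  · ext a
    simp only [Finset.mem_image, Finset.mem_range]
    constructor
    · rintro ⟨i, hi, rfl⟩
      simp only [hi, dif_pos]
      exact J.orderEmbOfFin_mem rfl _
    · intro ha
      have : a ∈ Set.range (J.orderEmbOfFin rfl) := by simpa using ha
      obtain ⟨⟨i, hi⟩, rfl⟩ := this
      exact ⟨i, hi, by simp [hi]⟩

/-! ### Schreier families -/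

theorem empty_mem_schreier_succ (n : ℕ) : (∅ : Finset ℕ+) ∈ Schreier (n + 1) :=
  ⟨0, fun _ => ∅, by simp, by simp, by simp, by simp⟩

theorem schreier_succ_of_mem {n : ℕ} {F : Finset ℕ+} (hF : F ∈ Schreier n) (hne : F.Nonempty) :
    F ∈ Schreier (n + 1) :=
  ⟨1, fun _ => F, fun _ _ => ⟨hne, hF⟩, fun j hj i hi => by omega, by simp,
    fun m _ => m.pos⟩

theorem singleton_mem_schreier (n : ℕ) (a : ℕ+) : {a} ∈ Schreier n := by
  induction n with
  | zero => exact ⟨a, rfl⟩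
  | succ n ih => exact schreier_succ_of_mem ih (Finset.singleton_nonempty a)

theorem schreier_of_card_le (n : ℕ) {F : Finset ℕ+} (h : ∀ m ∈ F, F.card ≤ (m : ℕ)) :
    F ∈ Schreier (n + 1) := by
  rcases F.eq_empty_or_nonempty with rfl | hne
  · exact empty_mem_schreier_succ n
  induction n with
  | zero => exact (mem_schreier_one F).2 h
  | succ n ih => exact schreier_succ_of_mem ih hne

/-- Empty pieces are allowed here, unlike in the definition. Discarding them only lowers the number
of pieces, so `d` still bounds it. -/
theorem biUnion_mem_schreier_succ {n d : ℕ} {E : ℕ → Finset ℕ+}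
    (hE : ∀ j < d, (E j).Nonempty → E j ∈ Schreier n)
    (hlt : ∀ j < d, ∀ i < j, ∀ a ∈ E i, ∀ b ∈ E j, a < b)
    (hd : ∀ j < d, ∀ a ∈ E j, d ≤ (a : ℕ)) :
    (Finset.range d).biUnion E ∈ Schreier (n + 1) := by
  classical
  obtain ⟨t, ht, hmono, him⟩ := exists_enum ((Finset.range d).filter fun j => (E j).Nonempty)
  set J := (Finset.range d).filter fun j => (E j).Nonempty
  have hJ : ∀ i < J.card, t i < d ∧ (E (t i)).Nonempty := fun i hi => by
    simpa [J] using ht i hi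
  refine ⟨J.card, fun i => E (t i), fun j hj => ⟨(hJ j hj).2, hE _ (hJ j hj).1 (hJ j hj).2⟩,
    fun j hj i hij => hlt _ (hJ j hj).1 _ (hmono i j hij hj), ?_, ?_⟩
  · ext a
    simp only [Finset.mem_biUnion, Finset.mem_range]
    constructor
    · rintro ⟨j, hj, ha⟩
      have : j ∈ (Finset.range J.card).image t := by
        rw [him]
        exact Finset.mem_filter.2 ⟨Finset.mem_range.2 hj, a, ha⟩
      obtain ⟨i, hi, rfl⟩ := Finset.mem_image.1 this
      exact ⟨i, Finset.mem_range.1 hi, ha⟩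
    · rintro ⟨i, hi, ha⟩
      exact ⟨t i, (hJ i hi).1, ha⟩
  · intro a ha
    obtain ⟨j, hj, ha⟩ := Finset.mem_biUnion.1 ha
    refine le_trans ?_ (hd j (Finset.mem_range.1 hj) a ha)
    exact (Finset.card_filter_le _ _).trans (Finset.card_range d).le

/-! ### Half sums and the structure of the norming set -/

/-- `f = ½ (g 0 + ⋯ + g (d - 1))` for successive, possibly zero, functionals `g j` in the norming
set whose supports are contained in `{d, d + 1, …}`. -/
structure IsHalfSum (D : CodingData) (d : ℕ) (g : ℕ → c00) (f : c00) : Prop where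
  mem : ∀ j < d, g j ∈ normingSet D
  precedes : ∀ j < d, ∀ i < j, Precedes (g i) (g j)
  le_support : ∀ j < d, ∀ a ∈ (g j).support, d ≤ (a : ℕ)
  eq : f = (1 / 2 : ℝ) • ∑ j ∈ Finset.range d, g j

theorem Precedes.mono {f g f' g' : c00} (h : Precedes f g) (hf : f'.support ⊆ f.support)
    (hg : g'.support ⊆ g.support) : Precedes f' g' :=
  fun a ha b hb => h a (hf ha) b (hg hb)

theorem support_restrict_subset (I : Set ℕ+) (f : c00) : (restrict I f).support ⊆ f.support :=
  fun _ hi => ((support_restrict I f).1 hi).1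

theorem IsHalfSum.restrict {d : ℕ} {g : ℕ → c00} {f : c00} (h : IsHalfSum D d g f) {I : Set ℕ+}
    (hI : I.OrdConnected) : IsHalfSum D d (fun j => ISP.restrict I (g j)) (ISP.restrict I f) where
  mem j hj := restrict_mem_normingSet (h.mem j hj) hI
  precedes j hj i hi := (h.precedes j hj i hi).mono (support_restrict_subset _ _)
    (support_restrict_subset _ _)
  le_support j hj a ha := h.le_support j hj a (support_restrict_subset _ _ ha)
  eq := by
    rw [h.eq]
    change restrictLin I _ = _
    rw [map_smul, map_sum]
    rfl

theorem IsHalfSum.neg {d : ℕ} {g : ℕ → c00} {f : c00} (h : IsHalfSum D d g f) :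
    IsHalfSum D d (fun j => -g j) (-f) where
  mem j hj := neg_mem_normingSet (h.mem j hj)
  precedes j hj i hi := (h.precedes j hj i hi).mono (Finsupp.support_neg _).le
    (Finsupp.support_neg _).le
  le_support j hj a ha := h.le_support j hj a (by rwa [Finsupp.support_neg] at ha)
  eq := by rw [h.eq, Finset.sum_neg_distrib, smul_neg]

/-- The functionals in the norming set that are supported by at most one coordinate or are half
sums. -/
def generators (D : CodingData) : Set c00 :=
  {f | f ∈ normingSet D ∧ ((∃ n, f.support ⊆ {n}) ∨ ∃ d g, IsHalfSum D d g f)}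

theorem exists_mem_support_of_mem_support_smul_sum {ι : Type*} {s : Finset ι} {f : ι → c00}
    {a : ℕ+} {c : ℝ} (ha : a ∈ (c • ∑ j ∈ s, f j).support) : ∃ j ∈ s, a ∈ (f j).support := by
  by_contra! h
  refine Finsupp.mem_support_iff.1 ha ?_
  rw [Finsupp.smul_apply, Finsupp.finsetSum_apply, Finset.sum_eq_zero, smul_zero]
  exact fun j hj => Finsupp.notMem_support_iff.1 (h j hj)

/-- Weighted sums of averages are half sums. -/
theorem IsWeighted.exists_isHalfSum {Avg : ℕ → c00 → Prop}
    (havg : ∀ s a, Avg s a → a ∈ normingSet D)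
    (hmem : ∀ n f, IsWeighted Avg n f → f ∈ normingSet D) {n : ℕ} {f : c00}
    (hf : IsWeighted Avg n f) : ∃ d g, IsHalfSum D d g f := by
  classical
  obtain ⟨hn, d, s, a, ha, ⟨-, hb, hS⟩, hv, rfl⟩ := hf
  obtain ⟨m, rfl⟩ : ∃ m, n = m + 1 := ⟨n - 1, by omega⟩
  obtain ⟨k, E, hE, hElt, hEF, hk⟩ := hS
  have hcover : ∀ j < d, ∃ r < k, minSupp (a j) ∈ E r := fun j hj => by
    have : minSupp (a j) ∈ (Finset.range k).biUnion E := by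
      rw [← hEF]
      exact Finset.mem_image_of_mem _ (Finset.mem_range.2 hj)
    simpa using this
  have hsub : ∀ r < k, ∀ b ∈ E r, ∃ j < d, minSupp (a j) = b := fun r hr b hbr => by
    have : b ∈ (Finset.range d).image fun i => minSupp (a i) := by
      rw [hEF]
      exact Finset.mem_biUnion.2 ⟨r, Finset.mem_range.2 hr, hbr⟩
    simpa using this
  -- `J r` collects the averages whose minimum lies in the `r`-th Schreier piece; these groups are
  -- the summands of the half sum.
  let J : ℕ → Finset ℕ := fun r => (Finset.range d).filter fun j => minSupp (a j) ∈ E r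
  have hJ : ∀ {r j}, j ∈ J r ↔ j < d ∧ minSupp (a j) ∈ E r := by simp [J]
  refine ⟨k, fun r => (1 / (2 : ℝ) ^ m) • ∑ j ∈ J r, a j, ⟨?_, ?_, ?_, ?_⟩⟩
  · intro r hr
    obtain ⟨t, ht, hmono, him⟩ := exists_enum (J r)
    have htd : ∀ i < (J r).card, t i < d := fun i hi => (hJ.1 (ht i hi)).1
    -- There is no rule of weight 0. For `m = 0` each piece is a singleton, so the group is a single
    -- average, already in `W`.
    rcases Nat.eq_zero_or_pos m with rfl | hm
    · obtain ⟨b, hEb⟩ := (hE r hr).2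
      obtain ⟨j, hj, hjb⟩ := hsub r hr b (by simp [hEb])
      have hJr : J r = {j} := by
        ext i
        rw [hJ, Finset.mem_singleton, hEb, Finset.mem_singleton]
        constructor
        · rintro ⟨hi, hib⟩
          exact hb.injOn_minSupp (by simpa using hi) (by simpa using hj) (hib.trans hjb.symm)
        · rintro rfl
          exact ⟨hj, hjb⟩
      simpa [hJr] using havg _ _ (ha j hj)
    · refine hmem m _ ⟨hm, (J r).card, fun i => s (t i), fun i => a (t i),
        fun i hi => ha _ (htd i hi), ⟨?_, hb.comp htd hmono, ?_⟩, hv.comp htd hmono, ?_⟩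
      · obtain ⟨b, hbr⟩ := (hE r hr).1
        obtain ⟨j, hj, rfl⟩ := hsub r hr b hbr
        exact Finset.card_pos.2 ⟨j, hJ.2 ⟨hj, hbr⟩⟩
      · have : (Finset.range (J r).card).image (fun i => minSupp (a (t i))) = E r := by
          change (Finset.range (J r).card).image ((fun i => minSupp (a i)) ∘ t) = E r
          rw [← Finset.image_image, him]
          ext b
          simp only [Finset.mem_image]
          constructor
          · rintro ⟨j, hj, rfl⟩
            exact (hJ.1 hj).2
          · intro hbr
            obtain ⟨j, hj, rfl⟩ := hsub r hr b hbr
            exact ⟨j, hJ.2 ⟨hj, hbr⟩, rfl⟩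
        rw [this]
        exact (hE r hr).2
      · congr 1
        conv_lhs => rw [← him]
        refine Finset.sum_image fun i hi j hj hij => ?_
        simp only [Finset.coe_range, Set.mem_Iio] at hi hj
        rcases lt_trichotomy i j with h | h | h
        · exact absurd hij (hmono i j h hj).ne
        · exact h
        · exact absurd hij (hmono j i h hi).ne'
  · intro r hr q hq x hx y hy
    obtain ⟨i, hi, hx⟩ := exists_mem_support_of_mem_support_smul_sum hx
    obtain ⟨j, hj, hy⟩ := exists_mem_support_of_mem_support_smul_sum hy
    rw [hJ] at hi hj
    exact hb.2 j hj.1 i (hb.lt_of_minSupp_lt hi.1 (hElt r hr q hq _ hi.2 _ hj.2)) x hx y hy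
  · intro r hr x hx
    obtain ⟨j, hj, hx⟩ := exists_mem_support_of_mem_support_smul_sum hx
    rw [hJ] at hj
    refine (hk (minSupp (a j)) (Finset.mem_image_of_mem _ (Finset.mem_range.2 hj.1))).trans ?_
    exact_mod_cast minSupp_le hx
  · have hU : Finset.range d = (Finset.range k).biUnion J := by
      ext j
      simp only [Finset.mem_range, Finset.mem_biUnion, hJ]
      exact ⟨fun hj => (hcover j hj).imp fun r hr => ⟨hr.1, hj, hr.2⟩, fun ⟨_, _, hj, _⟩ => hj⟩
    have hdisj : ∀ r ∈ Finset.range k, ∀ q ∈ Finset.range k, r ≠ q → Disjoint (J r) (J q) := by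
      intro r hr q hq hrq
      rw [Finset.mem_range] at hr hq
      refine Finset.disjoint_left.2 fun j hjr hjq => ?_
      rw [hJ] at hjr hjq
      rcases lt_or_gt_of_ne hrq with h | h
      · exact (hElt q hq r h _ hjr.2 _ hjq.2).false
      · exact (hElt r hr q h _ hjq.2 _ hjr.2).false
    rw [hU, Finset.sum_biUnion hdisj, ← Finset.smul_sum, smul_smul, pow_succ]
    congr 1
    field_simp

theorem IsSpecial.isHalfSum {d : ℕ} {f : ℕ → c00} {w : ℕ → ℕ}
    (h : IsSpecial D (normingSet D) d f w) :
    IsHalfSum D d f ((1 / 2 : ℝ) • ∑ j ∈ Finset.range d, f j) where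
  mem j hj := (h.2.1 j hj).mem_normingSet
  precedes := h.1.2.1.2
  -- In an `S 1`-admissible sequence the number `d` of minima is at most each of them.
  le_support j hj a ha := by
    have h1 := (mem_schreier_one _).1 h.1.2.2 (minSupp (f j))
      (Finset.mem_image_of_mem _ (Finset.mem_range.2 hj))
    rw [Finset.card_image_of_injOn h.1.2.1.injOn_minSupp, Finset.card_range] at h1
    exact h1.trans (by exact_mod_cast minSupp_le ha)
  eq := rfl

theorem map_mem_convexHull {E : Type*} [AddCommGroup E] [Module ℝ E] {s : Set E} (T : E →ₗ[ℝ] E)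
    (hT : ∀ f ∈ s, T f ∈ s) {f : E} (hf : f ∈ convexHull ℝ s) : T f ∈ convexHull ℝ s := by
  have h : T f ∈ T '' convexHull ℝ s := ⟨f, hf, rfl⟩
  rw [T.image_convexHull] at h
  exact convexHull_mono (Set.image_subset_iff.2 hT) h

/-- Minimality of `W`: the part of `W` inside the hull is itself a closed family. Negation and
interval restriction are linear and preserve the generators, hence also their hull. The three
building rules only produce half sums. -/
theorem normingSet_subset_convexHull : normingSet D ⊆ convexHull ℝ (generators D) := by
  have hW := isClosedFamily_normingSet D
  -- Intersecting with `W` matters: the summands of a half sum must lie in `W`, and membership in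
  -- the hull alone would not give this.
  set G : Set c00 := normingSet D ∩ convexHull ℝ (generators D)
  have hG : G ⊆ normingSet D := Set.inter_subset_left
  have hhalf : ∀ {d g f}, f ∈ normingSet D → IsHalfSum D d g f → f ∈ G := fun hf h =>
    ⟨hf, subset_convexHull ℝ _ ⟨hf, Or.inr ⟨_, _, h⟩⟩⟩
  have : IsClosedFamily D G := by
    refine ⟨?_, ?_, ?_, ?_, ?_, ?_, ?_⟩
    · exact fun n => ⟨hW.unit_mem n, subset_convexHull ℝ _
        ⟨hW.unit_mem n, Or.inl ⟨n, Finsupp.support_single_subset⟩⟩⟩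
    · refine fun f hf => ⟨hW.neg_mem f hf.1, map_mem_convexHull (-LinearMap.id) ?_ hf.2⟩
      rintro f ⟨hf, ⟨n, hn⟩ | ⟨d, g, hg⟩⟩
      · exact ⟨hW.neg_mem f hf, Or.inl ⟨n, (Finsupp.support_neg f).le.trans hn⟩⟩
      · exact ⟨hW.neg_mem f hf, Or.inr ⟨d, _, hg.neg⟩⟩
    · refine fun f hf I hI => ⟨hW.restrict_mem f hf.1 I hI,
        map_mem_convexHull (restrictLin I) ?_ hf.2⟩
      rintro f ⟨hf, ⟨n, hn⟩ | ⟨d, g, hg⟩⟩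
      · exact ⟨hW.restrict_mem f hf I hI, Or.inl ⟨n, (support_restrict_subset I f).trans hn⟩⟩
      · exact ⟨hW.restrict_mem f hf I hI, Or.inr ⟨d, _, hg.restrict hI⟩⟩
    · refine fun d f q hf hq h1 => ⟨hW.convex_mem d f q (fun i hi => (hf i hi).1) hq h1,
        (convex_convexHull ℝ _).sum_mem ?_ (by exact_mod_cast h1) ?_⟩
      · exact fun i hi => by exact_mod_cast hq i (Finset.mem_range.1 hi)
      · exact fun i hi => (hf i (Finset.mem_range.1 hi)).2
    · intro n f hf
      have hf' : IsWeighted (IsAlphaAverage (normingSet D)) n f :=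
        hf.mono fun _ _ => IsAlphaAverage.mono hG
      obtain ⟨d, g, hg⟩ := hf'.exists_isHalfSum (fun _ _ h => h.1) hW.typeIAlpha_mem
      exact hhalf (hW.typeIAlpha_mem n f hf') hg
    · intro n f hf
      have hf' : IsWeighted (IsBetaAverage D (normingSet D)) n f :=
        hf.mono fun _ _ => IsBetaAverage.mono hG
      obtain ⟨d, g, hg⟩ := hf'.exists_isHalfSum (fun _ _ h => h.1) hW.typeIBeta_mem
      exact hhalf (hW.typeIBeta_mem n f hf') hg
    · intro d f w hf
      have hf' : IsSpecial D (normingSet D) d f w := hf.mono hG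
      exact hhalf (hW.typeII_mem d f w hf') hf'.isHalfSum
  exact fun f hf => (normingSet_subset this hf).2

/-- To bound all functionals of the norming set at `x` it is enough to bound the generators. -/
theorem act_le_of_generators {x : c00} {C : ℝ} (h : ∀ f ∈ generators D, act f x ≤ C) {f : c00}
    (hf : f ∈ normingSet D) : act f x ≤ C := by
  have hconv : Convex ℝ {f : c00 | act f x ≤ C} := by
    have : {f : c00 | act f x ≤ C} = {f : c00 | actLin x f ≤ C} := by
      ext f
      rw [Set.mem_ofPred_eq, act_comm]
      rfl
    rw [this]
    exact convex_halfSpace_le (actLin x).isLinear C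
  exact convexHull_min h hconv (normingSet_subset_convexHull hf)

/-! ### Half sums acting on block sequences -/

/-- The supports of `f` and `g` intersect. -/
def Meets (f g : c00) : Prop := ∃ i ∈ f.support, i ∈ g.support

theorem act_eq_zero_of_not_meets {f x : c00} (h : ¬ Meets f x) : act f x = 0 :=
  act_eq_zero fun i hi hi' => h ⟨i, hi, hi'⟩

theorem Precedes.le_of_meets {d : ℕ} {g : ℕ → c00} (hg : ∀ j < d, ∀ i < j, Precedes (g i) (g j))
    {x y : c00} (hxy : Precedes x y) {i j : ℕ} (hi : i < d) (hix : Meets (g i) x)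
    (hjy : Meets (g j) y) : i ≤ j := by
  obtain ⟨a, ha, hax⟩ := hix
  obtain ⟨b, hb, hby⟩ := hjy
  by_contra! hlt
  exact (hxy a hax b hby).asymm (hg i hi j hlt b hb a ha)

/-- The action of a half sum on a combination of a block sequence splits into the action on the at
most `d` vectors met by several summands and the actions of the single summands. -/
theorem IsHalfSum.exists_split {d : ℕ} {g : ℕ → c00} {f : c00} (h : IsHalfSum D d g f)
    {A : Finset ℕ} {x : ℕ → c00} (hx : ∀ i ∈ A, ∀ j ∈ A, i < j → Precedes (x i) (x j)) :
    ∃ (E : Finset ℕ) (B : ℕ → Finset ℕ), E ⊆ A ∧ E.card ≤ d ∧ (∀ j, B j ⊆ A) ∧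
      (∀ i < d, ∀ j < d, i < j → ∀ a ∈ B i, ∀ b ∈ B j, a < b) ∧
      (∀ k ∈ E, ∃ j < d, Meets (g j) (x k)) ∧ (∀ j < d, ∀ k ∈ B j, Meets (g j) (x k)) ∧
      ∀ c : ℕ → ℝ, act f (∑ k ∈ A, c k • x k) = ∑ k ∈ E, c k * act f (x k) +
        1 / 2 * ∑ j ∈ Finset.range d, act (g j) (∑ k ∈ B j, c k • x k) := by
  classical
  -- `M k` is the set of summands that meet `x k`. `E` will consist of the `k` with at least two
  -- such summands, and `B j` of those with `M k = {j}`.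
  let M : ℕ → Finset ℕ := fun k => (Finset.range d).filter fun j => Meets (g j) (x k)
  have hM : ∀ {k j}, j ∈ M k ↔ j < d ∧ Meets (g j) (x k) := by simp [M]
  have hle : ∀ k ∈ A, ∀ l ∈ A, k < l → ∀ i ∈ M k, ∀ j ∈ M l, i ≤ j :=
    fun k hk l hl hkl i hi j hj => Precedes.le_of_meets h.precedes (hx k hk l hl hkl)
      (hM.1 hi).1 (hM.1 hi).2 (hM.1 hj).2
  refine ⟨A.filter fun k => 1 < (M k).card, fun j => A.filter fun k => M k = {j},
    Finset.filter_subset _ _, ?_, fun j => Finset.filter_subset _ _, ?_, ?_, ?_, ?_⟩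
  · have hlt : ∀ k ∈ A, ∀ l ∈ A, k < l → 1 < (M k).card → 1 < (M l).card →
        (M k).sup id < (M l).sup id := by
      intro k hk l hl hkl h1 h2
      obtain ⟨a, ha, b, hb, hab⟩ := Finset.one_lt_card_iff_nontrivial.1 h2
      have hs : ∀ i ∈ M l, (M k).sup id ≤ i := fun i hi => Finset.sup_le fun j hj =>
        hle k hk l hl hkl j hj i hi
      have ha' : a ≤ (M l).sup id := Finset.le_sup (f := id) ha
      have hb' : b ≤ (M l).sup id := Finset.le_sup (f := id) hb
      have := hs a ha
      have := hs b hb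
      omega
    conv_rhs => rw [← Finset.card_range d]
    refine Finset.card_le_card_of_injOn (fun k => (M k).sup id) ?_ ?_
    · intro k hk
      have hk := (Finset.mem_filter.1 hk).2
      have hd : 0 < d := by
        obtain ⟨a, ha⟩ := Finset.card_pos.1 (by omega : 0 < (M k).card)
        have := (hM.1 ha).1
        omega
      simp only [Finset.coe_range, Set.mem_Iio]
      exact (Finset.sup_lt_iff hd).2 fun j hj => (hM.1 hj).1
    · intro k hk l hl hkl
      have hk := Finset.mem_filter.1 hk
      have hl := Finset.mem_filter.1 hl
      rcases lt_trichotomy k l with hlt' | heq | hlt'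
      · exact absurd hkl (hlt k hk.1 l hl.1 hlt' hk.2 hl.2).ne
      · exact heq
      · exact absurd hkl (hlt l hl.1 k hk.1 hlt' hl.2 hk.2).ne'
  · intro i hi j hj hij a ha b hb
    rw [Finset.mem_filter] at ha hb
    by_contra! hba
    rcases hba.eq_or_lt with rfl | hlt
    · have := Finset.singleton_injective (ha.2.symm.trans hb.2)
      omega
    · have := hle b hb.1 a ha.1 hlt j (by simp [hb.2]) i (by simp [ha.2])
      omega
  · intro k hk
    obtain ⟨j, hj⟩ := Finset.card_pos.1 (zero_lt_one.trans (Finset.mem_filter.1 hk).2)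
    exact ⟨j, hM.1 hj⟩
  · intro j hj k hk
    exact (hM.1 (by simp [(Finset.mem_filter.1 hk).2] : j ∈ M k)).2
  · intro c
    have hf : ∀ k, act f (x k) = 1 / 2 * ∑ j ∈ Finset.range d, act (g j) (x k) := fun k => by
      rw [h.eq, smul_act, sum_act]
    simp only [act_sum_smul]
    simp only [Finset.sum_filter]
    rw [Finset.sum_comm, Finset.mul_sum, ← Finset.sum_add_distrib]
    refine Finset.sum_congr rfl fun k _ => ?_
    by_cases hk : 1 < (M k).card
    · rw [if_pos hk, Finset.sum_eq_zero, mul_zero, add_zero]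
      intro j _
      rw [if_neg]
      intro hj
      simp [hj] at hk
    · rw [if_neg hk, zero_add, hf, mul_left_comm, Finset.mul_sum]
      congr 1
      refine Finset.sum_congr rfl fun j hj => ?_
      split_ifs with hjk
      · rfl
      · rw [act_eq_zero_of_not_meets, mul_zero]
        intro hm
        have hjM : j ∈ M k := hM.2 ⟨Finset.mem_range.1 hj, hm⟩
        refine hjk (Finset.eq_singleton_iff_unique_mem.2 ⟨hjM, fun i hi => ?_⟩)
        exact Finset.card_le_one.1 (not_lt.1 hk) i hi j hjM

/-- Ordered sets are disjoint, so no coefficient is counted twice. -/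
theorem sum_le_of_ordered {d : ℕ} {A : Finset ℕ} {B : ℕ → Finset ℕ} (hBA : ∀ j < d, B j ⊆ A)
    (hB : ∀ i < d, ∀ j < d, i < j → ∀ a ∈ B i, ∀ b ∈ B j, a < b) {c : ℕ → ℝ}
    (hc : ∀ k ∈ A, 0 ≤ c k) : ∑ j ∈ Finset.range d, ∑ k ∈ B j, c k ≤ ∑ k ∈ A, c k := by
  classical
  rw [← Finset.sum_biUnion]
  · refine Finset.sum_le_sum_of_subset_of_nonneg
      (Finset.biUnion_subset.2 fun j hj => hBA j (Finset.mem_range.1 hj)) ?_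
    exact fun k hk _ => hc k hk
  · intro i hi j hj hij
    simp only [Finset.coe_range, Set.mem_Iio] at hi hj
    refine Finset.disjoint_left.2 fun a ha hb => ?_
    rcases lt_or_gt_of_ne hij with h | h
    · exact (hB i hi j hj h a ha a hb).false
    · exact (hB j hj i hi h a hb a ha).false

theorem act_sum_smul_le {f : c00} (hf : f ∈ normingSet D) {A : Finset ℕ} {c : ℕ → ℝ} {x : ℕ → c00}
    (hc : ∀ k ∈ A, 0 ≤ c k) {θ : ℝ} (hx : ∀ k ∈ A, wNorm D (x k) ≤ θ) :
    act f (∑ k ∈ A, c k • x k) ≤ θ * ∑ k ∈ A, c k := by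
  rw [act_sum_smul, Finset.mul_sum]
  refine Finset.sum_le_sum fun k hk => ?_
  rw [mul_comm]
  exact mul_le_mul_of_nonneg_right ((act_le_wNorm hf _).trans (hx k hk)) (hc k hk)

/-- A functional supported by one coordinate meets at most one vector of a block sequence. -/
theorem exists_act_eq_zero {f : c00} {n : ℕ+} (hf : f.support ⊆ {n}) {A : Finset ℕ} {x : ℕ → c00}
    (hA : A.Nonempty) (hx : ∀ i ∈ A, ∀ j ∈ A, i < j → Precedes (x i) (x j)) :
    ∃ k ∈ A, ∀ l ∈ A, l ≠ k → act f (x l) = 0 := by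
  by_cases h : ∃ k ∈ A, Meets f (x k)
  · obtain ⟨k, hk, a, ha, hak⟩ := h
    refine ⟨k, hk, fun l hl hlk => act_eq_zero fun b hb hbl => ?_⟩
    have h1 := Finset.mem_singleton.1 (hf ha)
    have h2 := Finset.mem_singleton.1 (hf hb)
    subst h1
    subst h2
    rcases lt_or_gt_of_ne hlk with h | h
    · exact (hx l hl k hk h _ hbl _ hak).false
    · exact (hx k hk l hl h _ hak _ hbl).false
  · push Not at h
    obtain ⟨k, hk⟩ := hA
    exact ⟨k, hk, fun l hl _ => act_eq_zero_of_not_meets (h l hl)⟩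

/-! ### The upper estimate -/

/-- The action of the norming set on a combination of a block sequence is controlled by the sum of
the coefficients and the sum over a Schreier set of the coefficients. -/
theorem exists_schreier_act_le (n : ℕ) {f : c00} (hf : f ∈ normingSet D) {A : Finset ℕ}
    {c : ℕ → ℝ} {x : ℕ → c00} (hc : ∀ k ∈ A, 0 ≤ c k) (hne : ∀ k ∈ A, x k ≠ 0)
    (hx : ∀ i ∈ A, ∀ j ∈ A, i < j → Precedes (x i) (x j)) (h1 : ∀ k ∈ A, wNorm D (x k) ≤ 1) :
    ∃ G ⊆ A, (G = ∅ ∨ G.image (fun k => minSupp (x k)) ∈ Schreier n) ∧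
      act f (∑ k ∈ A, c k • x k) ≤ 2 / 2 ^ (n + 1) * ∑ k ∈ A, c k + 4 * ∑ k ∈ G, c k := by
  classical
  induction n generalizing f A with
  | zero =>
    -- At level 0 the factor `2 / 2 ^ 1` is 1 and the triangle inequality suffices.
    refine ⟨∅, Finset.empty_subset _, Or.inl rfl, ?_⟩
    simpa using act_sum_smul_le hf hc h1
  | succ n ih =>
    rcases A.eq_empty_or_nonempty with rfl | hA
    · exact ⟨∅, Finset.empty_subset _, Or.inl rfl, (act_sum_smul_le hf hc h1).trans (by simp)⟩
    -- `G` maximizes the coefficient sum among the admissible subsets of `A`. It is thus independent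
    -- of `f`, which permits the reduction to generators, and every error term below is compared
    -- with this one sum.
    obtain ⟨G, hG, hGmax⟩ := (A.powerset.filter fun G => G = ∅ ∨
      G.image (fun k => minSupp (x k)) ∈ Schreier (n + 1)).exists_max_image (fun G => ∑ k ∈ G, c k)
      ⟨∅, by simp⟩
    simp only [Finset.mem_filter, Finset.mem_powerset] at hG hGmax
    refine ⟨G, hG.1, hG.2, ?_⟩
    have hmax : ∀ H ⊆ A, H.image (fun k => minSupp (x k)) ∈ Schreier (n + 1) →
        ∑ k ∈ H, c k ≤ ∑ k ∈ G, c k := fun H hH hS => hGmax H ⟨hH, Or.inr hS⟩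
    have hG0 : 0 ≤ ∑ k ∈ G, c k := Finset.sum_nonneg fun k hk => hc k (hG.1 hk)
    have hsing : ∀ k ∈ A, c k ≤ ∑ k ∈ G, c k := fun k hk => by
      have := hmax {k} (Finset.singleton_subset_iff.2 hk)
        (by simpa using singleton_mem_schreier (n + 1) _)
      simpa using this
    have hA0 : 0 ≤ ∑ k ∈ A, c k := Finset.sum_nonneg hc
    have hact : ∀ {f}, f ∈ normingSet D → ∀ k ∈ A, c k * act f (x k) ≤ c k := fun hf k hk =>
      mul_le_of_le_one_right (hc k hk) ((act_le_wNorm hf _).trans (h1 k hk))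
    refine act_le_of_generators ?_ hf
    rintro f ⟨hf, ⟨a, ha⟩ | ⟨d, g, hg⟩⟩
    · obtain ⟨k, hk, hzero⟩ := exists_act_eq_zero ha hA hx
      rw [act_sum_smul, Finset.sum_eq_single_of_mem k hk fun l hl hlk => by
        rw [hzero l hl hlk, mul_zero]]
      have h2 : 0 ≤ (2 : ℝ) / 2 ^ (n + 1 + 1) * ∑ k ∈ A, c k := by positivity
      linarith [hact hf k hk, hsing k hk]
    · by_cases hmeet : ∃ k ∈ A, ∃ j < d, Meets (g j) (x k)
      swap
      · push Not at hmeet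
        have : act f (∑ k ∈ A, c k • x k) = 0 := by
          rw [act_sum_smul]
          refine Finset.sum_eq_zero fun k hk => ?_
          rw [hg.eq, smul_act, sum_act, Finset.sum_eq_zero fun j hj =>
            act_eq_zero_of_not_meets (hmeet k hk j (Finset.mem_range.1 hj)), mul_zero, mul_zero]
        rw [this]
        positivity
      -- Let `k₀` be the first index met by a summand. Its vector may start before `d`, so it is
      -- treated separately. Every later vector that is met starts after a point of the support of
      -- some `g j`, hence beyond `d`.
      have hspec := Nat.find_spec hmeet
      have hmin := fun l hl => @Nat.find_min _ _ hmeet l hl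
      set k₀ := Nat.find hmeet
      obtain ⟨hk₀, j₀, hj₀, a, haj, hak⟩ := hspec
      have hd : ∀ k ∈ A.erase k₀, (∃ j < d, Meets (g j) (x k)) → d ≤ (minSupp (x k) : ℕ) := by
        intro k hk hm
        have hkA := Finset.mem_of_mem_erase hk
        have hlt : k₀ < k := by
          by_contra! hle
          exact hmin k (lt_of_le_of_ne hle (Finset.ne_of_mem_erase hk)) ⟨hkA, hm⟩
        have h2 := hx k₀ hk₀ k hkA hlt a hak _ (minSupp_mem (hne k hkA))
        exact (hg.le_support j₀ hj₀ a haj).trans (by exact_mod_cast h2.le)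
      have hsub : A.erase k₀ ⊆ A := Finset.erase_subset _ _
      obtain ⟨E, B, hEA, hEd, hBA, hB, hEm, hBm, heq⟩ := hg.exists_split
        (A := A.erase k₀) (x := x) fun i hi j hj => hx i (hsub hi) j (hsub hj)
      -- At most `d` minima, all at least `d`: these form a set in `S 1`, hence in `S (n + 1)`.
      have hE : ∑ k ∈ E, c k * act f (x k) ≤ ∑ k ∈ G, c k := by
        refine (Finset.sum_le_sum fun k hk => hact hf k (hsub (hEA hk))).trans ?_
        refine hmax E (hEA.trans hsub) (schreier_of_card_le n fun m hm => ?_)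
        obtain ⟨k, hk, rfl⟩ := Finset.mem_image.1 hm
        exact (Finset.card_image_le.trans hEd).trans (hd k (hEA hk) (hEm k hk))
      -- The inductive hypothesis is applied to each `g j` on `B j`; for `j ≥ d` the set `H` is a
      -- dummy that makes the choice total.
      have hex : ∀ j, ∃ H ⊆ B j, j < d → (H = ∅ ∨ H.image (fun k => minSupp (x k)) ∈ Schreier n) ∧
          act (g j) (∑ k ∈ B j, c k • x k) ≤
            2 / 2 ^ (n + 1) * ∑ k ∈ B j, c k + 4 * ∑ k ∈ H, c k := fun j => by
        have hjA := (hBA j).trans hsub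
        by_cases hj : j < d
        · obtain ⟨H, hH, h⟩ := ih (hg.mem j hj) (fun k hk => hc k (hjA hk))
            (fun k hk => hne k (hjA hk)) (fun i hi k hk => hx i (hjA hi) k (hjA hk))
            (fun k hk => h1 k (hjA hk))
          exact ⟨H, hH, fun _ => h⟩
        · exact ⟨∅, Finset.empty_subset _, fun h => absurd h hj⟩
      choose H hHB hH using hex
      have hHd : ∀ i < d, ∀ j < d, i < j → ∀ a ∈ H i, ∀ b ∈ H j, a < b :=
        fun i hi j hj hij a ha b hb => hB i hi j hj hij a (hHB i ha) b (hHB j hb)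
      have hHsum : ∑ j ∈ Finset.range d, ∑ k ∈ H j, c k ≤ ∑ k ∈ G, c k := by
        have hUA : (Finset.range d).biUnion H ⊆ A :=
          Finset.biUnion_subset.2 fun j _ => (hHB j).trans ((hBA j).trans hsub)
        refine (sum_le_of_ordered (fun j hj => Finset.subset_biUnion_of_mem H
          (Finset.mem_range.2 hj)) hHd fun k hk => hc k (hUA hk)).trans (hmax _ hUA ?_)
        -- At most `d` successive sets from `S n`, all beyond `d`, have their union in `S (n + 1)`.
        rw [Finset.biUnion_image]
        refine biUnion_mem_schreier_succ ?_ ?_ ?_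
        · intro j hj hne'
          rcases (hH j hj).1 with h | h
          · simp [h] at hne'
          · exact h
        · intro j hj i hij a ha b hb
          obtain ⟨k, hk, rfl⟩ := Finset.mem_image.1 ha
          obtain ⟨l, hl, rfl⟩ := Finset.mem_image.1 hb
          have hkA := hsub (hBA i (hHB i hk))
          have hlA := hsub (hBA j (hHB j hl))
          exact hx k hkA l hlA (hHd i (hij.trans hj) j hj hij k hk l hl) _
            (minSupp_mem (hne k hkA)) _ (minSupp_mem (hne l hlA))
        · intro j hj a ha
          obtain ⟨k, hk, rfl⟩ := Finset.mem_image.1 ha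
          exact hd k (hBA j (hHB j hk)) ⟨j, hj, hBm j hj k (hHB j hk)⟩
      have hBsum : ∑ j ∈ Finset.range d, ∑ k ∈ B j, c k ≤ ∑ k ∈ A, c k :=
        sum_le_of_ordered (fun j _ => (hBA j).trans hsub) hB hc
      have hgs : ∑ j ∈ Finset.range d, act (g j) (∑ k ∈ B j, c k • x k) ≤
          2 / 2 ^ (n + 1) * ∑ k ∈ A, c k + 4 * ∑ k ∈ G, c k := by
        refine (Finset.sum_le_sum fun j hj => (hH j (Finset.mem_range.1 hj)).2).trans ?_
        rw [Finset.sum_add_distrib, ← Finset.mul_sum, ← Finset.mul_sum]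
        gcongr
      -- The vector `k₀`, the set `E` and the halved inductive errors cost 1, 1 and `4 / 2` times
      -- the sum over `G`: the constant 4 reproduces itself.
      rw [← Finset.add_sum_erase _ _ hk₀, act_add, act_smul, heq]
      have h2 : (2 : ℝ) / 2 ^ (n + 1 + 1) = 1 / 2 * (2 / 2 ^ (n + 1)) := by
        rw [pow_succ (2 : ℝ) (n + 1)]
        field_simp
      rw [h2]
      linarith [hact hf k₀ hk₀, hsing k₀ hk₀]

theorem IsBlock.eq_of_minSupp_eq {m : ℕ} {x : ℕ → c00} (h : IsBlock m x) {i j : ℕ} (hi : i < m)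
    (hj : j < m) (hij : minSupp (x i) = minSupp (x j)) : i = j :=
  h.injOn_minSupp (by simpa using hi) (by simpa using hj) hij

/-- The upper estimate for special convex combinations. -/
theorem IsSCC.wNorm_le {n : ℕ} {ε : ℝ} {m : ℕ} {c : ℕ → ℝ} {x : ℕ → c00} (hn : 1 ≤ n)
    (h : IsSCC n ε m c x) (hx : ∀ k < m, wNorm D (x k) ≤ 1) :
    0 ≤ ε ∧ (∀ k < m, 0 ≤ c k) ∧ ∑ k ∈ Finset.range m, c k = 1 ∧ ∀ A ⊆ Finset.range m,
      wNorm D (∑ k ∈ A, c k • x k) ≤ 2 / (2 : ℝ) ^ n * ∑ k ∈ A, c k + 4 * ε := by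
  classical
  obtain ⟨hb, F, hyF, -, hF0, hF1, hFε⟩ := h
  set y := ∑ k ∈ Finset.range m, c k • unitVec (minSupp (x k)) with hy
  have hyc : ∀ k < m, y (minSupp (x k)) = c k := fun k hk => by
    rw [hy, Finsupp.finsetSum_apply, Finset.sum_eq_single_of_mem k (Finset.mem_range.2 hk)]
    · simp
    · intro l hl hlk
      rw [Finsupp.smul_apply, Finsupp.single_apply, if_neg, smul_zero]
      exact fun heq => hlk (hb.eq_of_minSupp_eq (Finset.mem_range.1 hl) hk heq)
  have hc0 : ∀ k < m, 0 ≤ c k := fun k hk => by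
    rw [← hyc k hk]
    by_cases hkF : minSupp (x k) ∈ F
    · exact hF0 _ hkF
    · rw [Finsupp.notMem_support_iff.1 fun h => hkF (hyF h)]
  -- `F` is nonempty because its coefficients sum to 1, and singletons belong to every Schreier
  -- family.
  have hε : 0 < ε := by
    obtain ⟨a, ha⟩ : F.Nonempty := by
      rw [Finset.nonempty_iff_ne_empty]
      rintro rfl
      simp at hF1
    have := hFε {a} (Finset.singleton_subset_iff.2 ha) (singleton_mem_schreier _ a)
    rw [Finset.sum_singleton] at this
    exact (hF0 a ha).trans_lt this
  have hsum : ∑ k ∈ Finset.range m, c k = 1 := by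
    have h1 : ∑ a ∈ F, y a = ∑ a ∈ (Finset.range m).image (fun k => minSupp (x k)), y a := by
      have hsub : y.support ⊆ (Finset.range m).image fun k => minSupp (x k) := fun a ha => by
        rw [hy, ← one_smul ℝ (∑ k ∈ Finset.range m, _)] at ha
        obtain ⟨k, hk, hka⟩ := exists_mem_support_of_mem_support_smul_sum ha
        have := Finsupp.support_single_subset (Finsupp.support_smul hka)
        exact Finset.mem_image.2 ⟨k, hk, (Finset.mem_singleton.1 this).symm⟩
      rw [← Finset.sum_subset hyF fun a _ ha => Finsupp.notMem_support_iff.1 ha,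
        ← Finset.sum_subset hsub fun a _ ha => Finsupp.notMem_support_iff.1 ha]
    rw [h1, Finset.sum_image hb.injOn_minSupp] at hF1
    rw [← hF1]
    exact Finset.sum_congr rfl fun k hk => (hyc k (Finset.mem_range.1 hk)).symm
  refine ⟨hε.le, hc0, hsum, fun A hA => ISP.wNorm_le fun f hf => ?_⟩
  have hAm : ∀ k ∈ A, k < m := fun k hk => Finset.mem_range.1 (hA hk)
  obtain ⟨n, rfl⟩ : ∃ k, n = k + 1 := ⟨n - 1, by omega⟩
  -- When `c k = 0` the minimum of `x k` need not lie in `F`, and the smallness condition concerns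
  -- only subsets of `F`. Such indices are dropped first.
  set A' := A.filter fun k => c k ≠ 0
  have hA' : A' ⊆ A := Finset.filter_subset _ _
  obtain ⟨G, hGA, hG, hle⟩ := exists_schreier_act_le n hf (A := A') (c := c) (x := x)
    (fun k hk => hc0 k (hAm k (hA' hk))) (fun k hk => hb.1 k (hAm k (hA' hk)))
    (fun i hi j hj hij => hb.2 j (hAm j (hA' hj)) i hij) (fun k hk => hx k (hAm k (hA' hk)))
  have e1 : ∑ k ∈ A', c k • x k = ∑ k ∈ A, c k • x k := by
    refine Finset.sum_subset hA' fun k hk hk' => ?_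
    have : c k = 0 := by simpa [A', hk] using hk'
    rw [this, zero_smul]
  have e2 : ∑ k ∈ A', c k = ∑ k ∈ A, c k := Finset.sum_filter_ne_zero _
  have hGε : ∑ k ∈ G, c k ≤ ε := by
    rcases hG with rfl | hG
    · simpa using hε.le
    · have hGm : ∀ k ∈ G, k < m := fun k hk => hAm k (hA' (hGA hk))
      have h2 := hFε (G.image fun k => minSupp (x k)) (fun a ha => hyF ?_) (by simpa using hG)
      · rw [Finset.sum_image fun i hi j hj =>
          hb.eq_of_minSupp_eq (hGm i hi) (hGm j hj)] at h2
        rw [← Finset.sum_congr rfl fun k hk => hyc k (hGm k hk)]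
        exact h2.le
      · obtain ⟨k, hk, rfl⟩ := Finset.mem_image.1 ha
        rw [Finsupp.mem_support_iff, hyc k (hGm k hk)]
        exact (Finset.mem_filter.1 (hGA hk)).2
  rw [e1, e2] at hle
  linarith

/-! ### Successive averages -/

/-- Each vector is chosen beyond a bound `b k` that dominates all earlier supports. The property `P`
may depend on this bound, so sizes can be adapted to what has already been chosen. -/
theorem exists_block_seq {P : ℕ → c00 → Prop}
    (h : ∀ N, ∃ x, P N x ∧ ∀ a ∈ x.support, N < (a : ℕ)) (N : ℕ) :
    ∃ (x : ℕ → c00) (b : ℕ → ℕ), b 0 = N ∧ StrictMono b ∧ (∀ k, P (b k) (x k)) ∧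
      (∀ k, ∀ a ∈ (x k).support, b k < (a : ℕ) ∧ (a : ℕ) ≤ b (k + 1)) ∧
      ∀ i j, i < j → Precedes (x i) (x j) := by
  choose X hP hX using h
  let b : ℕ → ℕ := fun k =>
    Nat.rec N (fun _ b => max (b + 1) ((X b).support.sup fun a : ℕ+ => (a : ℕ))) k
  have hb : ∀ k, b (k + 1) = max (b k + 1) ((X (b k)).support.sup fun a : ℕ+ => (a : ℕ)) :=
    fun k => rfl
  have hmono : StrictMono b := strictMono_nat_of_lt_succ fun k => by
    have := le_max_left (b k + 1) ((X (b k)).support.sup fun a : ℕ+ => (a : ℕ))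
    rw [← hb] at this
    omega
  have hs : ∀ k, ∀ a ∈ (X (b k)).support, b k < (a : ℕ) ∧ (a : ℕ) ≤ b (k + 1) := fun k a ha =>
    ⟨hX _ a ha, (Finset.le_sup (f := fun a : ℕ+ => (a : ℕ)) ha).trans
      ((hb k).ge.trans' (le_max_right _ _))⟩
  refine ⟨fun k => X (b k), b, rfl, hmono, fun k => hP _, hs, fun i j hij p hp q hq => ?_⟩
  have h1 := (hs i p hp).2
  have h2 := (hs j q hq).1
  have h3 : b (i + 1) ≤ b j := hmono.monotone hij
  exact PNat.coe_lt_coe _ _ |>.1 (show (p : ℕ) < (q : ℕ) by omega)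

/-- A mean of successive functionals keeps the lower bound `δ` by linearity and stays in `W` by
rational convexity, so averages of every size exist arbitrarily far out. -/
theorem exists_alphaAverage {Λ : c00 →ₗ[ℝ] ℝ} {δ : ℝ} (hδ : 0 < δ)
    (h : ∀ N : ℕ, ∃ f, (f ∈ normingSet D ∧ δ ≤ Λ f) ∧ ∀ a ∈ f.support, N < (a : ℕ)) {s : ℕ}
    (hs : 0 < s) (N : ℕ) :
    ∃ f, (IsAlphaAverage (normingSet D) s f ∧ δ ≤ Λ f) ∧ ∀ a ∈ f.support, N < (a : ℕ) := by
  obtain ⟨x, b, hb0, hb, hP, hsupp, hprec⟩ := exists_block_seq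
    (P := fun _ f => f ∈ normingSet D ∧ δ ≤ Λ f) h N
  have hs0 : (0 : ℝ) < s := by exact_mod_cast hs
  have hne : ∀ k, x k ≠ 0 := fun k h0 => by
    have := (hP k).2
    rw [h0, map_zero] at this
    linarith
  refine ⟨(1 / (s : ℝ)) • ∑ i ∈ Finset.range s, x i, ⟨⟨?_, s, x, hs, le_rfl, fun i _ => (hP i).1,
    ⟨fun i _ => hne i, fun j _ i hij => hprec i j hij⟩, rfl⟩, ?_⟩, fun a ha => ?_⟩
  · have := (isClosedFamily_normingSet D).convex_mem s x (fun _ => 1 / (s : ℚ))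
      (fun i _ => (hP i).1) (fun i _ => by positivity) (by
        have : (s : ℚ) ≠ 0 := by exact_mod_cast hs.ne'
        simp [this])
    rw [Finset.smul_sum]
    simpa using this
  · rw [map_smul, map_sum, smul_eq_mul]
    have : ∑ i ∈ Finset.range s, δ ≤ ∑ i ∈ Finset.range s, Λ (x i) :=
      Finset.sum_le_sum fun i _ => (hP i).2
    rw [Finset.sum_const, Finset.card_range, nsmul_eq_mul] at this
    rw [one_div, ← div_eq_inv_mul, le_div_iff₀ hs0]
    linarith
  · obtain ⟨i, -, hi⟩ := exists_mem_support_of_mem_support_smul_sum ha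
    have h1 := (hsupp i a hi).1
    have h2 := hb.monotone (Nat.zero_le i)
    omega

/-- If a linear form is bounded below by `δ` on functionals of the norming set with arbitrarily far
supports, then it is unbounded on the norming set. -/
theorem exists_mem_normingSet_le {Λ : c00 →ₗ[ℝ] ℝ} {δ : ℝ} (hδ : 0 < δ)
    (h : ∀ N : ℕ, ∃ f, (f ∈ normingSet D ∧ δ ≤ Λ f) ∧ ∀ a ∈ f.support, N < (a : ℕ)) {d : ℕ}
    (hd : 0 < d) : ∃ f ∈ normingSet D, d * δ / 2 ≤ Λ f := by
  -- Starting beyond `d` makes `d` averages `S 1`-admissible. The size `2 ^ N + 1`, with `N`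
  -- bounding the earlier supports, makes them very fast growing.
  obtain ⟨x, b, hb0, hb, hP, hsupp, hprec⟩ := exists_block_seq
    (P := fun N f => IsAlphaAverage (normingSet D) (2 ^ N + 1) f ∧ δ ≤ Λ f)
    (fun N => exists_alphaAverage hδ h (Nat.succ_pos _) N) d
  have hne : ∀ k, x k ≠ 0 := fun k h0 => by
    have := (hP k).2
    rw [h0, map_zero] at this
    linarith
  have hbl : IsBlock d x := ⟨fun i _ => hne i, fun j _ i hij => hprec i j hij⟩
  refine ⟨_, (isClosedFamily_normingSet D).typeIAlpha_mem 1 _ ⟨one_pos, d,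
    fun j => 2 ^ b j + 1, x, fun j _ => (hP j).1, ⟨hd, hbl, ?_⟩, ⟨hbl, ?_⟩, rfl⟩, ?_⟩
  · rw [mem_schreier_one]
    intro m hm
    obtain ⟨k, hk, rfl⟩ := Finset.mem_image.1 hm
    refine Finset.card_image_le.trans ?_
    rw [Finset.card_range]
    have h1 := (hsupp k _ (minSupp_mem (hne k))).1
    have h2 := hb.monotone (Nat.zero_le k)
    omega
  · intro j _
    refine ⟨fun i hi => ?_, ?_⟩
    · exact Nat.lt_succ_of_le (Nat.pow_le_pow_right two_pos (hsupp j i hi).2)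
    · exact Nat.succ_lt_succ (Nat.pow_lt_pow_right one_lt_two (hb j.lt_succ_self))
  · rw [map_smul, map_sum, smul_eq_mul]
    have : ∑ i ∈ Finset.range d, δ ≤ ∑ i ∈ Finset.range d, Λ (x i) :=
      Finset.sum_le_sum fun i _ => (hP i).2
    rw [Finset.sum_const, Finset.card_range, nsmul_eq_mul] at this
    linarith

/-! ### Averages of far-out blocks have smaller norm -/

theorem IsHalfSum.le_of_mem_support {d : ℕ} {g : ℕ → c00} {f : c00} (h : IsHalfSum D d g f)
    {a : ℕ+} (ha : a ∈ f.support) : d ≤ (a : ℕ) := by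
  rw [h.eq] at ha
  obtain ⟨j, hj, ha⟩ := exists_mem_support_of_mem_support_smul_sum ha
  exact h.le_support j (Finset.mem_range.1 hj) a ha

/-- A half sum of `d` functionals acts on an average of `m` successive vectors as a contraction by
`½ + d / m`. -/
theorem IsHalfSum.act_average_le {d : ℕ} {g : ℕ → c00} {f : c00} (h : IsHalfSum D d g f)
    (hf : f ∈ normingSet D) {m : ℕ} (hm : 0 < m) {x : ℕ → c00} {θ : ℝ}
    (hx : ∀ i j, i < j → Precedes (x i) (x j)) (hθ : ∀ k, wNorm D (x k) ≤ θ) :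
    act f (∑ k ∈ Finset.range m, (1 / (m : ℝ)) • x k) ≤ θ * (d / m + 1 / 2) := by
  obtain ⟨E, B, hEA, hEd, hBA, hB, -, -, heq⟩ := h.exists_split (A := Finset.range m)
    (x := x) fun i _ j _ => hx i j
  have hm0 : (0 : ℝ) < m := by exact_mod_cast hm
  have hθ0 : 0 ≤ θ := (wNorm_nonneg D _).trans (hθ 0)
  have hc : ∀ A : Finset ℕ, ∀ k ∈ A, (0 : ℝ) ≤ 1 / (m : ℝ) := fun _ _ _ => by positivity
  rw [heq fun _ => 1 / (m : ℝ), ← act_sum_smul]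
  have h1 := act_sum_smul_le hf (hc E) (fun k _ => hθ k)
  have h2 : ∑ j ∈ Finset.range d, act (g j) (∑ k ∈ B j, (1 / (m : ℝ)) • x k) ≤ θ * 1 := by
    refine (Finset.sum_le_sum fun j hj => act_sum_smul_le (h.mem j (Finset.mem_range.1 hj))
      (hc (B j)) fun k _ => hθ k).trans ?_
    rw [← Finset.mul_sum]
    refine mul_le_mul_of_nonneg_left ?_ hθ0
    refine (sum_le_of_ordered (fun j _ => hBA j) hB (hc _)).trans ?_
    simp [hm0.ne']
  -- The at most `d` vectors met by several summands contribute `θ * d / m`; the remaining ones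
  -- carry the factor `1 / 2`.
  have h3 : ∑ k ∈ E, 1 / (m : ℝ) ≤ d / m := by
    rw [Finset.sum_const, nsmul_eq_mul, mul_one_div]
    gcongr
  have h4 := mul_le_mul_of_nonneg_left h3 hθ0
  linarith

theorem exists_average {Λ : c00 →ₗ[ℝ] ℝ} {δ θ : ℝ}
    (h : ∀ N : ℕ, ∃ x, (wNorm D x ≤ θ ∧ δ ≤ Λ x) ∧ ∀ a ∈ x.support, N < (a : ℕ)) {m : ℕ}
    (hm : 0 < m) (N : ℕ) :
    ∃ x, (wNorm D x ≤ θ ∧ δ ≤ Λ x ∧ ∀ d g f, IsHalfSum D d g f → f ∈ normingSet D →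
      act f x ≤ θ * (d / m + 1 / 2)) ∧ ∀ a ∈ x.support, N < (a : ℕ) := by
  obtain ⟨x, b, hb0, hb, hP, hsupp, hprec⟩ := exists_block_seq
    (P := fun _ x => wNorm D x ≤ θ ∧ δ ≤ Λ x) h N
  have hm0 : (0 : ℝ) < m := by exact_mod_cast hm
  have hs : ∑ k ∈ Finset.range m, 1 / (m : ℝ) = 1 := by simp [hm0.ne']
  refine ⟨∑ k ∈ Finset.range m, (1 / (m : ℝ)) • x k, ⟨wNorm_le fun f hf => ?_, ?_,
    fun d g f hg hf => hg.act_average_le hf hm hprec fun k => (hP k).1⟩, fun a ha => ?_⟩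
  · refine (act_sum_smul_le hf (fun _ _ => by positivity) fun k _ => (hP k).1).trans ?_
    rw [hs, mul_one]
  · have hδ : δ = ∑ k ∈ Finset.range m, 1 / (m : ℝ) * δ := by rw [← Finset.sum_mul, hs, one_mul]
    rw [map_sum, hδ]
    refine Finset.sum_le_sum fun k _ => ?_
    rw [map_smul, smul_eq_mul]
    exact mul_le_mul_of_nonneg_left (hP k).2 (by positivity)
  · rw [← Finset.smul_sum] at ha
    obtain ⟨i, -, hi⟩ := exists_mem_support_of_mem_support_smul_sum ha
    have h1 := (hsupp i a hi).1
    have h2 := hb.monotone (Nat.zero_le i)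
    omega

/-- Eight averages are averaged again, the one chosen beyond `N` having length `8 * (N + 1)`. If a
half sum first meets `x k`, then `d` is at most the end of that vector, so on every later average it
acts by at most `(1 / 8 + 1 / 2) * θ`. Only `x k` can be worse, and `(7 * (5 / 8) + 1) / 8 = 43 / 64
< 3 / 4`. -/
theorem exists_wNorm_le_three_quarters {Λ : c00 →ₗ[ℝ] ℝ} {δ θ : ℝ}
    (h : ∀ N : ℕ, ∃ x, (wNorm D x ≤ θ ∧ δ ≤ Λ x) ∧ ∀ a ∈ x.support, N < (a : ℕ)) (N : ℕ) :
    ∃ x, (wNorm D x ≤ 3 / 4 * θ ∧ δ ≤ Λ x) ∧ ∀ a ∈ x.support, N < (a : ℕ) := by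
  classical
  obtain ⟨x, b, hb0, hb, hP, hsupp, hprec⟩ := exists_block_seq
    (P := fun N x => wNorm D x ≤ θ ∧ δ ≤ Λ x ∧ ∀ d g f, IsHalfSum D d g f → f ∈ normingSet D →
      act f x ≤ θ * (d / (8 * (N + 1) : ℕ) + 1 / 2))
    (fun N => exists_average h (by positivity) N) N
  have hθ0 : 0 ≤ θ := (wNorm_nonneg D _).trans (hP 0).1
  refine ⟨(1 / 8 : ℝ) • ∑ i ∈ Finset.range 8, x i, ⟨wNorm_le fun f hf => ?_, ?_⟩, fun a ha => ?_⟩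
  · refine act_le_of_generators ?_ hf
    intro f hf
    obtain ⟨k, hk⟩ : ∃ k, ∀ i < 8, i ≠ k → act f (x i) ≤ 5 / 8 * θ := by
      rcases hf with ⟨hf, ⟨n, hn⟩ | ⟨d, g, hg⟩⟩
      · obtain ⟨k, -, hk⟩ := exists_act_eq_zero hn (A := Finset.range 8) (x := x) (by simp)
          fun i _ j _ => hprec i j
        refine ⟨k, fun i hi hik => ?_⟩
        rw [hk i (Finset.mem_range.2 hi) hik]
        positivity
      · by_cases hmeet : ∃ k, Meets f (x k)
        · have hspec := Nat.find_spec hmeet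
          have hmin := fun l hl => @Nat.find_min _ _ hmeet l hl
          set k := Nat.find hmeet
          refine ⟨k, fun i _ hik => ?_⟩
          rcases lt_or_gt_of_ne hik with hlt | hlt
          · rw [act_eq_zero_of_not_meets (hmin i hlt)]
            positivity
          · obtain ⟨a, ha, hax⟩ := hspec
            have hd : d ≤ b i := (hg.le_of_mem_support ha).trans
              ((hsupp k a hax).2.trans (hb.monotone hlt))
            have h1 : (d : ℝ) / (8 * (b i + 1) : ℕ) ≤ 1 / 8 := by
              have : (d : ℝ) ≤ b i := by exact_mod_cast hd
              push_cast
              rw [div_le_div_iff₀ (by positivity) (by norm_num)]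
              linarith
            refine ((hP i).2.2 d g f hg hf).trans ?_
            rw [mul_comm]
            exact mul_le_mul_of_nonneg_right (by linarith) hθ0
        · push Not at hmeet
          refine ⟨0, fun i _ _ => ?_⟩
          rw [act_eq_zero_of_not_meets (hmeet i)]
          positivity
    rw [act_smul, act_sum]
    have hle : ∀ i ∈ Finset.range 8, act f (x i) ≤ 5 / 8 * θ + if k = i then 3 / 8 * θ else 0 := by
      intro i hi
      split_ifs with hik
      · have := (act_le_wNorm hf.1 (x i)).trans (hP i).1
        linarith
      · rw [add_zero]
        exact hk i (Finset.mem_range.1 hi) (Ne.symm hik)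
    have hsum := Finset.sum_le_sum hle
    rw [Finset.sum_add_distrib, Finset.sum_const, Finset.card_range, Finset.sum_ite_eq] at hsum
    have : (if k ∈ Finset.range 8 then 3 / 8 * θ else 0) ≤ 3 / 8 * θ := by
      split_ifs
      · exact le_rfl
      · positivity
    simp only [nsmul_eq_mul, Nat.cast_ofNat] at hsum
    linarith
  · rw [map_smul, map_sum, smul_eq_mul]
    have : ∑ i ∈ Finset.range 8, δ ≤ ∑ i ∈ Finset.range 8, Λ (x i) :=
      Finset.sum_le_sum fun i _ => (hP i).2.1
    rw [Finset.sum_const, Finset.card_range, nsmul_eq_mul] at this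
    push_cast at this
    linarith
  · obtain ⟨i, -, hi⟩ := exists_mem_support_of_mem_support_smul_sum ha
    have h1 := (hsupp i a hi).1
    have h2 := hb.monotone (Nat.zero_le i)
    omega

/-- A bounded linear form is small on far unit vectors. -/
theorem exists_forall_support_lt {Λ : c00 →ₗ[ℝ] ℝ} {C δ : ℝ} (hΛ : ∀ x, Λ x ≤ C * wNorm D x)
    (hC : 0 ≤ C) (hδ : 0 < δ) :
    ∃ N : ℕ, ∀ x, wNorm D x ≤ 1 → (∀ a ∈ x.support, N < (a : ℕ)) → Λ x < δ := by
  by_contra! h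
  -- The norm tends to 0 while `Λ` stays above `δ`, against boundedness.
  have hn : ∀ n N : ℕ, ∃ x, (wNorm D x ≤ (3 / 4 : ℝ) ^ n ∧ δ ≤ Λ x) ∧
      ∀ a ∈ x.support, N < (a : ℕ) := by
    intro n
    induction n with
    | zero =>
      intro N
      obtain ⟨x, h1, h2, h3⟩ := h N
      exact ⟨x, ⟨by simpa using h1, h3⟩, h2⟩
    | succ n ih =>
      rw [pow_succ']
      exact exists_wNorm_le_three_quarters ih
  have hlim : Tendsto (fun n : ℕ => C * (3 / 4 : ℝ) ^ n) atTop (𝓝 (C * 0)) :=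
    (tendsto_pow_atTop_nhds_zero_of_lt_one (by norm_num) (by norm_num)).const_mul C
  rw [mul_zero] at hlim
  obtain ⟨n, hn'⟩ := (hlim.eventually (gt_mem_nhds hδ)).exists
  obtain ⟨x, ⟨h1, h2⟩, -⟩ := hn n 0
  have h3 := (hΛ x).trans (mul_le_mul_of_nonneg_left h1 hC)
  linarith

/-! ### Reflexivity of spaces with a shrinking and boundedly complete basis -/

/-- James' theorem: a Banach space with a shrinking and boundedly complete basis is reflexive. -/
theorem IsShrinking.isReflexive {X : Type*} [NormedAddCommGroup X] [NormedSpace ℝ X]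
    [CompleteSpace X] {b : SchauderBasis ℝ X} (hs : IsShrinking b) (hc : IsBoundedlyComplete b) :
    IsReflexive X := by
  intro Φ
  obtain ⟨K, hK⟩ := b.exists_norm_proj_le
  have hK0 : 0 ≤ K := (norm_nonneg _).trans (hK 0)
  -- The candidate preimage is `∑ Φ(b.coord i) • b i`. Its partial sums are bounded because pairing
  -- them with `f` gives `Φ (f ∘L b.proj n)`.
  obtain ⟨x, hx⟩ := hc (fun i => Φ (b.coord i)) ⟨K * ‖Φ‖, fun n => by
    refine NormedSpace.norm_le_dual_bound ℝ _ (by positivity) fun f => ?_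
    have h1 : f (∑ i ∈ Finset.range n, Φ (b.coord i) • b i) = Φ (f ∘L b.proj n) := by
      have : f ∘L b.proj n = ∑ i ∈ Finset.range n, f (b i) • b.coord i := by
        ext y
        simp [mul_comm]
      rw [this]
      simp [mul_comm]
    rw [h1]
    calc ‖Φ (f ∘L b.proj n)‖ ≤ ‖Φ‖ * ‖f ∘L b.proj n‖ := Φ.le_opNorm _
      _ ≤ ‖Φ‖ * (‖f‖ * K) := by
        gcongr
        exact (f.opNorm_comp_le _).trans (mul_le_mul_of_nonneg_left (hK n) (norm_nonneg f))
      _ = K * ‖Φ‖ * ‖f‖ := by ring⟩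
  have hcoord : ∀ j, b.coord j x = Φ (b.coord j) := fun j => by
    refine tendsto_nhds_unique (((b.coord j).continuous.tendsto x).comp hx) ?_
    refine tendsto_const_nhds.congr' ?_
    filter_upwards [eventually_gt_atTop j] with n hn
    simp [b.ortho, Pi.single_apply, hn]
  refine ⟨x, ?_⟩
  set T := NormedSpace.inclusionInDoubleDual ℝ X x - Φ with hT
  -- The difference of the two bidual elements vanishes on the coordinate functionals, hence on
  -- their closed span, which is the whole dual.
  have hle : (Submodule.span ℝ (Set.range b.coord)).topologicalClosure ≤ T.ker := by
    refine Submodule.topologicalClosure_minimal _ (Submodule.span_le.2 ?_) T.isClosed_ker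
    rintro _ ⟨j, rfl⟩
    simp [hT, hcoord]
  rw [IsShrinking] at hs
  rw [hs] at hle
  ext f
  have : T f = 0 := hle (Submodule.mem_top (x := f))
  simpa [hT, sub_eq_zero] using this

/-! ### The unit vector basis -/

variable (D)

/-- The inclusion of `c₀₀`, as a linear map. -/
noncomputable def toXISPLin : c00 →ₗ[ℝ] XISP D where
  toFun := toXISP D
  map_add' x y := UniformSpace.Completion.coe_add (α := NormedC00 D) x y
  map_smul' c x := UniformSpace.Completion.coe_smul (X := NormedC00 D) c x

theorem toXISPLin_apply (x : c00) : toXISPLin D x = toXISP D x := rfl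

theorem norm_toXISPLin (x : c00) : ‖toXISPLin D x‖ = wNorm D x := norm_toXISP D x

theorem induction_on_c00 {p : XISP D → Prop} (x : XISP D) (hp : IsClosed {x | p x})
    (h : ∀ x : c00, p (toXISPLin D x)) : p x :=
  UniformSpace.Completion.induction_on x hp h

theorem exists_dual_of_bound (T : c00 →ₗ[ℝ] ℝ) (C : ℝ) (hT : ∀ x, |T x| ≤ C * wNorm D x) :
    ∃ φ : StrongDual ℝ (XISP D), ∀ x, φ (toXISPLin D x) = T x := by
  let T' : NormedC00 D →ₗ[ℝ] ℝ :=
    { toFun := fun x => T (show c00 from x)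
      map_add' := T.map_add
      map_smul' := T.map_smul }
  let T'' : NormedC00 D →L[ℝ] ℝ := T'.mkContinuous C hT
  refine ⟨T''.extend UniformSpace.Completion.toComplL, fun x => ?_⟩
  exact ContinuousLinearMap.extend_eq T'' UniformSpace.Completion.denseRange_coe
    (UniformSpace.Completion.isUniformInducing_coe _) (show NormedC00 D from x)

theorem exists_coord (n : ℕ+) :
    ∃ φ : StrongDual ℝ (XISP D), ∀ x, φ (toXISPLin D x) = x n := by
  obtain ⟨φ, hφ⟩ := exists_dual_of_bound D (actLin (unitVec n)) 1 fun x => by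
    rw [one_mul]
    exact abs_act_le_wNorm ((isClosedFamily_normingSet D).unit_mem n) x
  exact ⟨φ, fun x => (hφ x).trans (act_unitVec n x)⟩

/-- The coordinate functionals. -/
noncomputable def coordFun (n : ℕ+) : StrongDual ℝ (XISP D) := (exists_coord D n).choose

theorem coordFun_apply (n : ℕ+) (x : c00) : coordFun D n (toXISPLin D x) = x n :=
  (exists_coord D n).choose_spec x

theorem sum_smul_unitVec_apply (a : ℕ → ℝ) (n : ℕ) (k : ℕ+) :
    (∑ i ∈ Finset.range n, a i • unitVec i.succPNat) k =
      if (k : ℕ) ≤ n then a k.natPred else 0 := by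
  have h : ∀ i : ℕ, i.succPNat = k ↔ k.natPred = i := fun i =>
    ⟨fun h => by rw [← h, Nat.natPred_succPNat], fun h => by rw [← h, PNat.succPNat_natPred]⟩
  rw [Finsupp.finsetSum_apply]
  simp only [Finsupp.smul_apply, Finsupp.single_apply, smul_eq_mul, mul_ite, mul_one, mul_zero, h]
  rw [Finset.sum_ite_eq]
  -- Coordinates start at 1 and the summation index at 0, so `k - 1 < n` becomes `k ≤ n`.
  have h1 : k.natPred ∈ Finset.range n ↔ (k : ℕ) ≤ n := by
    have := PNat.natPred_add_one k
    rw [Finset.mem_range]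
    omega
  simp only [h1]

theorem ordConnected_le (n : ℕ) : {k : ℕ+ | (k : ℕ) ≤ n}.OrdConnected :=
  ⟨fun _ _ _ hy _ hz => (PNat.coe_le_coe _ _ |>.2 hz.2).trans hy⟩

theorem ordConnected_gt (n : ℕ) : {k : ℕ+ | n < (k : ℕ)}.OrdConnected :=
  ⟨fun _ hx _ _ _ hz => lt_of_lt_of_le hx (PNat.coe_le_coe _ _ |>.2 hz.1)⟩

theorem restrict_le_eq_sum (n : ℕ) (x : c00) : restrict {k : ℕ+ | (k : ℕ) ≤ n} x =
    ∑ i ∈ Finset.range n, x i.succPNat • unitVec i.succPNat := by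
  classical
  ext k
  rw [sum_smul_unitVec_apply (fun i => x i.succPNat), restrict_apply, PNat.succPNat_natPred]
  rfl

theorem restrict_gt_eq_sub (n : ℕ) (x : c00) : restrict {k : ℕ+ | n < (k : ℕ)} x =
    x - restrict {k : ℕ+ | (k : ℕ) ≤ n} x := by
  classical
  ext k
  rw [Finsupp.sub_apply, restrict_apply, restrict_apply]
  simp only [Set.mem_ofPred_eq]
  split_ifs <;> first | omega | simp

/-- The projection on the first `n` coordinates. -/
noncomputable def partialSum (n : ℕ) : XISP D →L[ℝ] XISP D :=
  ∑ i ∈ Finset.range n,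
    (coordFun D i.succPNat).smulRight (toXISPLin D (unitVec i.succPNat))

theorem partialSum_apply (n : ℕ) (x : XISP D) : partialSum D n x =
    ∑ i ∈ Finset.range n, coordFun D i.succPNat x • toXISPLin D (unitVec i.succPNat) := by
  simp [partialSum, _root_.sum_apply, ContinuousLinearMap.smulRight_apply]

theorem partialSum_toXISPLin (n : ℕ) (x : c00) :
    partialSum D n (toXISPLin D x) = toXISPLin D (restrict {k : ℕ+ | (k : ℕ) ≤ n} x) := by
  rw [partialSum_apply, restrict_le_eq_sum, map_sum]
  simp only [coordFun_apply, map_smul]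

theorem norm_partialSum_le (n : ℕ) (x : XISP D) : ‖partialSum D n x‖ ≤ ‖x‖ := by
  refine induction_on_c00 D (p := fun x => ‖partialSum D n x‖ ≤ ‖x‖) x
    (isClosed_le (by fun_prop) (by fun_prop)) fun x => ?_
  rw [partialSum_toXISPLin, norm_toXISPLin, norm_toXISPLin]
  exact wNorm_restrict_le x (ordConnected_le n)

theorem tendsto_partialSum (x : XISP D) :
    Tendsto (fun n => partialSum D n x) atTop (𝓝 x) := by
  rw [Metric.tendsto_atTop]
  intro ε hε
  have hd : DenseRange (toXISPLin D) := UniformSpace.Completion.denseRange_coe (α := NormedC00 D)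
  obtain ⟨y, hy⟩ := hd.exists_dist_lt x (half_pos hε)
  refine ⟨y.support.sup fun a : ℕ+ => (a : ℕ), fun n hn => ?_⟩
  have h1 : restrict {k : ℕ+ | (k : ℕ) ≤ n} y = y := by
    classical
    ext k
    rw [restrict_apply]
    split_ifs with h
    · rfl
    · by_contra hk
      exact h ((Finset.le_sup (f := fun a : ℕ+ => (a : ℕ))
        (Finsupp.mem_support_iff.2 (Ne.symm hk))).trans hn)
  have h2 : partialSum D n (toXISPLin D y) = toXISPLin D y := by
    rw [partialSum_toXISPLin, h1]
  rw [dist_eq_norm] at hy ⊢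
  have h3 : partialSum D n x - x =
      partialSum D n (x - toXISPLin D y) - (x - toXISPLin D y) := by
    rw [map_sub, h2]
    abel
  rw [h3]
  have h4 := norm_sub_le (partialSum D n (x - toXISPLin D y)) (x - toXISPLin D y)
  have h5 := norm_partialSum_le D n (x - toXISPLin D y)
  linarith

/-- The unit vectors form a Schauder basis. -/
noncomputable def unitBasis : SchauderBasis ℝ (XISP D) where
  basis i := toXISP D (unitVec i.succPNat)
  coord i := coordFun D i.succPNat
  ortho i j := by
    have h : ∀ inst : DecidableEq ℕ, unitVec j.succPNat i.succPNat =
        (Pi.single j (1 : ℝ) : ℕ → ℝ) i := by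
      intro inst
      simp [Finsupp.single_apply, Pi.single_apply, eq_comm]
    rw [← toXISPLin_apply, coordFun_apply]
    exact h _
  expansion x := by
    rw [HasSum, SummationFilter.conditional_filter_eq_map_range, tendsto_map'_iff]
    refine (tendsto_partialSum D x).congr fun n => ?_
    rw [partialSum_apply]
    rfl

/-- The functionals `φ ∘L partialSum D N` lie in the span of the coordinates, and their distance to
`φ` is governed by `φ` on vectors supported beyond `N`, where `exists_forall_support_lt` applies. A
positive distance `δ` from the closed span is contradicted by an approximation within `δ / 2`. -/
theorem isShrinking_unitBasis : IsShrinking (unitBasis D) := by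
  rw [IsShrinking, eq_top_iff]
  intro φ _
  by_contra hφ
  set S := (Submodule.span ℝ (Set.range (unitBasis D).coord)).topologicalClosure
  have hS : IsClosed (S : Set (StrongDual ℝ (XISP D))) := Submodule.isClosed_topologicalClosure _
  have hδ := (hS.notMem_iff_infDist_pos ⟨0, S.zero_mem⟩).1 hφ
  set δ := Metric.infDist φ (S : Set (StrongDual ℝ (XISP D)))
  obtain ⟨N, hN⟩ := exists_forall_support_lt (D := D) (Λ := φ.toLinearMap ∘ₗ toXISPLin D)
    (C := ‖φ‖) (δ := δ / 2) (fun x => by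
      rw [← norm_toXISPLin]
      exact (le_abs_self _).trans (φ.le_opNorm _)) (norm_nonneg φ) (half_pos hδ)
  have hmem : φ ∘L partialSum D N ∈ S := by
    refine Submodule.le_topologicalClosure _ ?_
    have : φ ∘L partialSum D N = ∑ i ∈ Finset.range N,
        φ (toXISPLin D (unitVec i.succPNat)) • (unitBasis D).coord i := by
      ext y
      rw [ContinuousLinearMap.comp_apply, partialSum_apply]
      simp [unitBasis, mul_comm]
    rw [this]
    exact Submodule.sum_mem _ fun i _ => Submodule.smul_mem _ _ (Submodule.subset_span ⟨i, rfl⟩)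
  have hle := Metric.infDist_le_dist_of_mem (x := φ) hmem
  rw [dist_eq_norm] at hle
  refine absurd (hle.trans (ContinuousLinearMap.opNorm_le_bound _ (half_pos hδ).le fun x => ?_))
    (half_lt_self hδ).not_ge
  refine induction_on_c00 D (p := fun x => ‖(φ - φ ∘L partialSum D N) x‖ ≤ δ / 2 * ‖x‖) x
    (isClosed_le (by fun_prop) (by fun_prop)) fun x => ?_
  have h1 : (φ - φ ∘L partialSum D N) (toXISPLin D x) =
      φ (toXISPLin D (restrict {k : ℕ+ | N < (k : ℕ)} x)) := by
    rw [restrict_gt_eq_sub, map_sub, map_sub]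
    simp [partialSum_toXISPLin]
  rw [h1, norm_toXISPLin]
  set z := restrict {k : ℕ+ | N < (k : ℕ)} x with hz
  have hzx : wNorm D z ≤ wNorm D x := wNorm_restrict_le x (ordConnected_gt N)
  -- The bound for far-out vectors is one-sided and for norm at most 1, so it is applied to `± z`
  -- divided by the norm of `x`, which dominates that of `z`.
  have hsigned : ∀ s : ℝ, |s| = 1 → s * φ (toXISPLin D z) ≤ δ / 2 * wNorm D x := by
    intro s hs
    rcases (wNorm_nonneg D x).eq_or_lt with h0 | hpos
    · have h2 : toXISPLin D z = 0 := by
        rw [← norm_le_zero_iff, norm_toXISPLin, h0]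
        exact hzx
      rw [h2, ← h0, map_zero, mul_zero, mul_zero]
    · have h3 := hN ((s * (wNorm D x)⁻¹) • z) ?_ ?_
      · rw [LinearMap.comp_apply, map_smul, map_smul, smul_eq_mul] at h3
        have h4 : s * φ (toXISPLin D z) =
            s * (wNorm D x)⁻¹ * φ (toXISPLin D z) * wNorm D x := by
          field_simp
        rw [h4]
        exact mul_le_mul_of_nonneg_right h3.le hpos.le
      · refine (wNorm_smul_le D _ z).trans ?_
        rw [abs_mul, hs, one_mul, abs_inv, abs_of_pos hpos, inv_mul_le_iff₀ hpos, mul_one]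
        exact hzx
      · exact fun a ha => ((support_restrict _ x).1 (Finsupp.support_smul ha)).2
  refine abs_le'.2 ⟨?_, ?_⟩
  · simpa using hsigned 1 (by simp)
  · simpa using hsigned (-1) (by simp)

/-- This lets a functional act on the formal series `∑ a i e_i`: past the support of `f` the
truncation no longer matters. -/
theorem act_eq_linearCombination {f : c00} (a : ℕ → ℝ) {n : ℕ}
    (hf : ∀ k ∈ f.support, (k : ℕ) ≤ n) :
    act f (∑ i ∈ Finset.range n, a i • unitVec i.succPNat) =
      Finsupp.linearCombination ℝ (fun k : ℕ+ => a k.natPred) f := by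
  rw [Finsupp.linearCombination_apply]
  refine Finset.sum_congr rfl fun k hk => ?_
  simp only [sum_smul_unitVec_apply, smul_eq_mul]
  rw [if_pos (hf k hk)]

theorem isBoundedlyComplete_unitBasis : IsBoundedlyComplete (unitBasis D) := by
  classical
  rintro a ⟨C, hC⟩
  set v : ℕ → c00 := fun n => ∑ i ∈ Finset.range n, a i • unitVec i.succPNat with hv
  have hs : ∀ n, ∑ i ∈ Finset.range n, a i • unitBasis D i = toXISPLin D (v n) := fun n => by
    rw [hv, map_sum]
    simp only [map_smul]
    rfl
  simp only [hs] at hC ⊢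
  refine cauchySeq_tendsto_of_complete ?_
  by_contra hcauchy
  rw [Metric.cauchySeq_iff'] at hcauchy
  push Not at hcauchy
  obtain ⟨ε, hε, hcauchy⟩ := hcauchy
  set Λ := Finsupp.linearCombination ℝ (fun k : ℕ+ => a k.natPred)
  have hΛ : ∀ f ∈ normingSet D, Λ f ≤ C := fun f hf => by
    rw [← act_eq_linearCombination a (n := f.support.sup fun k : ℕ+ => (k : ℕ))
      fun k hk => Finset.le_sup (f := fun k : ℕ+ => (k : ℕ)) hk]
    refine (act_le_wNorm hf _).trans ?_
    rw [← norm_toXISPLin]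
    exact hC _
  have hfar : ∀ N : ℕ, ∃ f, (f ∈ normingSet D ∧ ε / 2 ≤ Λ f) ∧
      ∀ k ∈ f.support, N < (k : ℕ) := by
    intro N
    obtain ⟨n, hn, hdist⟩ := hcauchy N
    rw [dist_eq_norm, ← map_sub, norm_toXISPLin] at hdist
    obtain ⟨f, hf, hfv⟩ : ∃ f ∈ normingSet D, ε / 2 < act f (v n - v N) := by
      by_contra! h
      have := hdist.trans (wNorm_le h)
      linarith
    -- Cutting `f` down to the interval `(N, n]` moves its support beyond `N`, and its action on the
    -- formal series is that of `f` on `v n - v N`.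
    refine ⟨restrict {k : ℕ+ | N < (k : ℕ)} (restrict {k : ℕ+ | (k : ℕ) ≤ n} f),
      ⟨restrict_mem_normingSet (restrict_mem_normingSet hf (ordConnected_le n))
        (ordConnected_gt N), ?_⟩, fun k hk => ((support_restrict _ _).1 hk).2⟩
    have hn : ∀ k ∈ (restrict {k : ℕ+ | N < (k : ℕ)} (restrict {k : ℕ+ | (k : ℕ) ≤ n} f)).support,
        (k : ℕ) ≤ n := fun k hk =>
      ((support_restrict _ _).1 (support_restrict_subset _ _ hk)).2
    rw [← act_eq_linearCombination a hn, act_restrict, act_restrict]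
    have : restrict {k : ℕ+ | (k : ℕ) ≤ n} (restrict {k : ℕ+ | N < (k : ℕ)} (v n)) =
        v n - v N := by
      ext k
      simp only [restrict_apply, Finsupp.sub_apply, hv, sum_smul_unitVec_apply, Set.mem_ofPred_eq]
      split_ifs <;> first | omega | simp
    change _ ≤ act f (restrict _ (restrict _ (v n)))
    rw [this]
    exact hfv.le
  -- With `δ = ε / 2`, the lower estimate for `d + 1` averages is `(d + 1) * ε / 4`, which exceeds
  -- `C`.
  obtain ⟨d, hd⟩ := exists_nat_gt (C / (ε / 4))
  obtain ⟨f, hf, hle⟩ := exists_mem_normingSet_le (half_pos hε) hfar d.succ_pos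
  have h1 := hle.trans (hΛ f hf)
  rw [div_lt_iff₀ (by positivity)] at hd
  push_cast at h1
  linarith

end ISP

theorem corollary2p24 (D : ISP.CodingData) :
    -- the space is reflexive
    ISP.IsReflexive (ISP.XISP D) ∧
    -- the unit vectors form a shrinking and boundedly complete Schauder basis
    (∃ b : SchauderBasis ℝ (ISP.XISP D),
      (∀ i : ℕ, b i = ISP.toXISP D (ISP.unitVec i.succPNat)) ∧
      ISP.IsShrinking b ∧ ISP.IsBoundedlyComplete b) ∧
    -- the upper estimate for special convex combinations
    (∀ (n : ℕ) (ε : ℝ) (m : ℕ) (c : ℕ → ℝ) (x : ℕ → ISP.c00), 1 ≤ n → ISP.IsSCC n ε m c x →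
      (∀ k < m, ‖ISP.toXISP D (x k)‖ ≤ 1) →
      (∀ F ⊆ Finset.range m, ‖∑ k ∈ F, c k • ISP.toXISP D (x k)‖ ≤
        6 / (2 : ℝ) ^ n * ∑ k ∈ F, c k + 12 * ε) ∧
      ‖∑ k ∈ Finset.range m, c k • ISP.toXISP D (x k)‖ ≤ 6 / (2 : ℝ) ^ n + 12 * ε) := by
  have hs := ISP.isShrinking_unitBasis D
  have hc := ISP.isBoundedlyComplete_unitBasis D
  refine ⟨hs.isReflexive hc, ⟨ISP.unitBasis D, fun _ => rfl, hs, hc⟩, ?_⟩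
  intro n ε m c x hn hscc hx
  obtain ⟨hε, hc0, hc1, hle⟩ := hscc.wNorm_le (D := D) hn fun k hk => by
    rw [← ISP.norm_toXISP]
    exact hx k hk
  have hF : ∀ F ⊆ Finset.range m, ‖∑ k ∈ F, c k • ISP.toXISP D (x k)‖ ≤
      6 / (2 : ℝ) ^ n * ∑ k ∈ F, c k + 12 * ε := fun F hF => by
    have h1 : ∑ k ∈ F, c k • ISP.toXISP D (x k) =
        ISP.toXISPLin D (∑ k ∈ F, c k • x k) := by
      rw [map_sum]
      simp only [map_smul]
      rfl
    have h2 : 0 ≤ ∑ k ∈ F, c k :=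
      Finset.sum_nonneg fun k hk => hc0 k (Finset.mem_range.1 (hF hk))
    rw [h1, ISP.norm_toXISPLin]
    refine (hle F hF).trans ?_
    -- The proven constants 2 and 4 are relaxed to 6 and 12, which uses that `ε` and the coefficient
    -- sum are nonnegative.
    gcongr <;> norm_num
  refine ⟨hF, ?_⟩
  have := hF _ subset_rfl
  rwa [hc1, mul_one] at this
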